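/- Let $(Y,g)$ be a complete smooth Riemannian manifold whose sectional curvatures are bounded, $|K|\le\Lambda$ for some constant $\Lambda$. Let $f:Y\to\mathbb{R}$ be a smooth function and $\delta>0$ a constant such that 1. $\|\operatorname{grad} f\|\equiv 1$; 2. $f$ has pinched convex levels: there are constants $0<c_1\le c_2$ such that $c_1\le (f\circ c)''(0)\le c_2$ for every unit speed geodesic $c:(-\eta,\eta)\to Y$ with $\dot c(0)\perp \operatorname{grad} f(c(0))$; 3. $K(\sigma_p)<-\delta$ for every $p\in Y$ and every tangent plane $\sigma_p\subset T_pY$ containing $\operatorname{grad} f(p)$. Then $(Y,g)$ is Lipschitz equivalent to a Riemannian manifold of pinched negative sectional curvature. More precisely, for $\lambda>0$ let $h^\lambda$ be the metric on $Y$ for which $\mathbb{R}\operatorname{grad} f$ and its $g$-orthogonal complement are orthogonal, which agrees with $g$ on this complement and with $\lambda^{-2}g$ on $\mathbb{R}\operatorname{grad} f$, that is, $h^\lambda=g-(1-\lambda^{-2})\,df\otimes df$. Then there is $\lambda_0>0$ such that for every $\lambda\ge\lambda_0$: $h^\lambda$ is a smooth Riemannian metric; there are constants $0<a\le b$ (which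 may depend on $\lambda$) such that all sectional curvatures of $h^\lambda$ lie in $[-b^2,-a^2]$; and the identity map is bi-Lipschitz between the Riemannian distances of $g$ and $h^\lambda$. -/

import Mathlib

open scoped Manifold ContDiff Topology ENNReal NNReal Bundle

noncomputable section

/-! ### Riemannian geometry in coordinates

`G : E → E →L[ℝ] E →L[ℝ] ℝ` is a metric tensor on (an open subset of) a finite-dimensional vector
space `E`: `G x u v` is the inner product at `x` of the constant vectors `u` and `v`. -/

section Coordinates

variable {E : Type*} [NormedAddCommGroup E] [NormedSpace ℝ E]

/-- The Christoffel form of the first kind, as a covector: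
`w ↦ (D_u G (v, w) + D_v G (u, w) - D_w G (u, v)) / 2`, which is `⟨∇_u v, w⟩` for the Levi-Civita
connection `∇` of `G` and constant vector fields `u`, `v`, `w`. -/
def christoffelFirst (G : E → E →L[ℝ] E →L[ℝ] ℝ) (x u v : E) : E →L[ℝ] ℝ :=
  (1 / 2 : ℝ) • (fderiv ℝ G x u v + fderiv ℝ G x v u - ((fderiv ℝ G x).flip u).flip v)

/-- The Christoffel symbols `Γ_x(u, v) = Γ^k_{ij} u^i v^j ∂_k`: the vector `∇_u v` at `x` for
constant vector fields `u`, `v`. The index is raised with the inverse of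
`G x : E →L[ℝ] (E →L[ℝ] ℝ)`. -/
def christoffel (G : E → E →L[ℝ] E →L[ℝ] ℝ) (x u v : E) : E :=
  (G x).inverse (christoffelFirst G x u v)

/-- The curvature tensor `R(u, v) w = ∇_u ∇_v w - ∇_v ∇_u w` for constant vector fields. -/
def riemannTensor (G : E → E →L[ℝ] E →L[ℝ] ℝ) (x u v w : E) : E :=
  fderiv ℝ (fun y => christoffel G y v w) x u - fderiv ℝ (fun y => christoffel G y u w) x v
    + christoffel G x u (christoffel G x v w) - christoffel G x v (christoffel G x u w)

/-- The sectional curvature `⟨R(u, v) v, u⟩ / (|u|² |v|² - ⟨u, v⟩²)` at `x` of the plane spanned by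
`u` and `v`. -/
def coordSectionalCurvature (G : E → E →L[ℝ] E →L[ℝ] ℝ) (x u v : E) : ℝ :=
  G x (riemannTensor G x u v v) u / (G x u u * G x v v - G x u v ^ 2)

end Coordinates

/-! ### Riemannian manifolds -/

section Manifold

/-- A smooth Riemannian metric on the manifold `Y` modelled on `E`. -/
abbrev SmoothMetric (E : Type*) [NormedAddCommGroup E] [NormedSpace ℝ E]
    (Y : Type*) [TopologicalSpace Y] [ChartedSpace E Y] [IsManifold 𝓘(ℝ, E) ∞ Y] :=
  Bundle.ContMDiffRiemannianMetric 𝓘(ℝ, E) ∞ E (fun p : Y => TangentSpace 𝓘(ℝ, E) p)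

variable {E : Type*} [NormedAddCommGroup E] [NormedSpace ℝ E]
  {Y : Type*} [TopologicalSpace Y] [ChartedSpace E Y] [IsManifold 𝓘(ℝ, E) ∞ Y]

/-- The Riemannian distance of `g`: the infimum of the lengths of `C^1` paths (`∞` between
different connected components). -/
def riemDist (g : SmoothMetric E Y) (p q : Y) : ℝ≥0∞ :=
  letI : Bundle.RiemannianBundle (fun p : Y => TangentSpace 𝓘(ℝ, E) p) := ⟨g.toRiemannianMetric⟩
  Manifold.riemannianEDist 𝓘(ℝ, E) p q

/-- The metric `g` is complete: every Cauchy sequence for the Riemannian distance converges. -/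
def IsCompleteMetric (g : SmoothMetric E Y) : Prop :=
  ∀ u : ℕ → Y,
    (∀ ε : ℝ≥0∞, 0 < ε → ∃ N : ℕ, ∀ m ≥ N, ∀ n ≥ N, riemDist g (u m) (u n) < ε) →
      ∃ p : Y, Filter.Tendsto u Filter.atTop (𝓝 p)

/-- The metric tensor of `g` in the chart around `q`, `G_x(u, v) = g(dψ_x u, dψ_x v)` where `ψ` is
the inverse of the chart (every `TangentSpace 𝓘(ℝ, E) p` is a copy of `E`). It is relevant for `x` in the (open) image of the chart. -/
def coordMetric (g : SmoothMetric E Y) (q : Y) (x : E) : E →L[ℝ] E →L[ℝ] ℝ :=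
  let ψ : Y := (extChartAt 𝓘(ℝ, E) q).symm x
  let dψ : E →L[ℝ] E := mfderiv 𝓘(ℝ, E) 𝓘(ℝ, E) (extChartAt 𝓘(ℝ, E) q).symm x
  let gψ : E →L[ℝ] E →L[ℝ] ℝ := g.inner ψ
  gψ.bilinearComp dψ dψ

/-- The sectional curvature at `p` of the plane spanned by the tangent vectors `u`, `v`, computed in
the chart around `p`. -/
def sectionalCurvature (g : SmoothMetric E Y) (p : Y) (u v : TangentSpace 𝓘(ℝ, E) p) : ℝ :=
  coordSectionalCurvature (coordMetric g p) (extChartAt 𝓘(ℝ, E) p p)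
    (mfderiv 𝓘(ℝ, E) 𝓘(ℝ, E) (extChartAt 𝓘(ℝ, E) p) p u)
    (mfderiv 𝓘(ℝ, E) 𝓘(ℝ, E) (extChartAt 𝓘(ℝ, E) p) p v)

/-- The sectional curvatures of all tangent planes lie in an interval `[-b², -a²]`, `0 < a ≤ b`. -/
def HasPinchedNegativeCurvature (g : SmoothMetric E Y) : Prop :=
  ∃ a b : ℝ, 0 < a ∧ a ≤ b ∧
    ∀ (p : Y) (u v : TangentSpace 𝓘(ℝ, E) p), LinearIndependent ℝ ![u, v] →
      -b ^ 2 ≤ sectionalCurvature g p u v ∧ sectionalCurvature g p u v ≤ -a ^ 2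

/-- The gradient of `f`: the vector representing the differential `df_p` with respect to `g`. -/
def riemGrad (g : SmoothMetric E Y) (f : Y → ℝ) (p : Y) : TangentSpace 𝓘(ℝ, E) p :=
  (g.inner p).inverse (mfderiv 𝓘(ℝ, E) 𝓘(ℝ, ℝ) f p)

/-- The velocity vector of a curve. -/
def velocity (c : ℝ → Y) (t : ℝ) : TangentSpace 𝓘(ℝ, E) (c t) :=
  mfderiv 𝓘(ℝ, ℝ) 𝓘(ℝ, E) c t (1 : ℝ)

/-- `c` is a geodesic of `g` on the open interval `(a, b)`: it is `C^2` and at each time `t` it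
satisfies the geodesic equation `x'' + Γ_x(x', x') = 0` in a chart around `c t`. (The left-hand side
is the covariant acceleration `∇_{c'} c'` in coordinates, so that the chart does not matter.) -/
def IsGeodesicOn (g : SmoothMetric E Y) (c : ℝ → Y) (a b : ℝ) : Prop :=
  ContMDiffOn 𝓘(ℝ, ℝ) 𝓘(ℝ, E) 2 c (Set.Ioo a b) ∧
    ∀ t ∈ Set.Ioo a b, ∃ q : Y, c t ∈ (chartAt E q).source ∧
      let x : ℝ → E := fun s => extChartAt 𝓘(ℝ, E) q (c s)
      deriv (deriv x) t + christoffel (coordMetric g q) (x t) (deriv x t) (deriv x t) = 0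

/-- `c` is a unit speed geodesic of `g` on `(a, b)`. -/
def IsUnitSpeedGeodesicOn (g : SmoothMetric E Y) (c : ℝ → Y) (a b : ℝ) : Prop :=
  IsGeodesicOn g c a b ∧
    ∀ t ∈ Set.Ioo a b, g.inner (c t) (velocity c t) (velocity c t) = 1

/-- `f` has pinched convex levels: `c₁ ≤ (f ∘ c)''(0) ≤ c₂` for some constants `0 < c₁ ≤ c₂` and all
unit speed geodesics `c : (-η, η) → Y` with `c'(0)` orthogonal to `grad f`. -/
def HasPinchedConvexLevels (g : SmoothMetric E Y) (f : Y → ℝ) : Prop :=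
  ∃ c₁ c₂ : ℝ, 0 < c₁ ∧ c₁ ≤ c₂ ∧
    ∀ (η : ℝ) (c : ℝ → Y), 0 < η → IsUnitSpeedGeodesicOn g c (-η) η →
      g.inner (c 0) (velocity c 0) (riemGrad g f (c 0)) = 0 →
        c₁ ≤ deriv (deriv (f ∘ c)) 0 ∧ deriv (deriv (f ∘ c)) 0 ≤ c₂

/-- `h` is the metric `g` stretched by `l` in the direction of the unit vector field `grad f`: the
splitting into `ℝ grad f` and its `g`-orthogonal complement remains orthogonal, `h = g` on the
complement, and `h = g / l²` on `ℝ grad f`. -/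
def IsStretchedMetric (g : SmoothMetric E Y) (f : Y → ℝ) (l : ℝ) (h : SmoothMetric E Y) : Prop :=
  ∀ (p : Y) (s t : ℝ) (u v : TangentSpace 𝓘(ℝ, E) p),
    g.inner p u (riemGrad g f p) = 0 → g.inner p v (riemGrad g f p) = 0 →
      h.inner p (s • riemGrad g f p + u) (t • riemGrad g f p + v) = s * t / l ^ 2 + g.inner p u v

/-- The identity map is a bi-Lipschitz map between the Riemannian distances of `g` and `h`. -/
def LipschitzEquivalent (g h : SmoothMetric E Y) : Prop :=
  ∃ L : ℝ≥0, ∀ p q : Y,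
    riemDist g p q ≤ L * riemDist h p q ∧ riemDist h p q ≤ L * riemDist g p q

end Manifold

end

noncomputable section

set_option maxSynthPendingDepth 3
set_option linter.unusedSectionVars false

/-! ### Levi-Civita calculus of a metric in coordinates -/

section CoordinateGeometry

variable {E : Type*} [NormedAddCommGroup E] [NormedSpace ℝ E]

/-! Write N = grad f and H = Hess f. Differentiating |N| = 1 gives H(N, ·) = 0. Passing from g to h
= g - (1 - λ⁻²) df ⊗ df adds only -(λ² - 1) H ⊗ N to the Levi-Civita connection, and since H
annihilates N, the curvature acquires no term quadratic in λ² - 1. The derivatives of H that do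
appear are turned into curvature of g by the Ricci identity, and they cancel when the index is
lowered with h. What remains is the Gauss type formula h(R^h(u,v)v, u) = g(R(u,v)v, u) - (λ² - 1)
(H(u,u) H(v,v) - H(u,v)²), a case of `apply_riemannTensor_stretch`.

Every plane has a g-orthogonal basis u = sN + w, v with v and w tangent to the level of f. Its Gram
determinant for h is (s²/λ² + |w|²)|v|², while the determinant of H sees only w and v and lies
between c₁²|w|²|v|² and c₂²|w|²|v|². The curvature of g contributes at most -δs²|v|² from N, a mixed
term, and a multiple of |w|²|v|². The mixed term is controlled by comparing the planes spanned by sN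
± tw and v: for large t it costs at most half of the gain δs²|v|², plus a multiple of |w|²|v|². For
large λ the term (λ² - 1)c₁²|w|²|v|² absorbs all multiples of |w|²|v|². Dividing by the Gram
determinant gives both bounds (`coordSectionalCurvature_stretch_bounds`).

The bounds on H come from solving the geodesic equation in a chart with a unit initial vector
tangent to the level, because (f ∘ c)'' = H(c', c') along a geodesic
(`coordHessian_bounds_of_levels`). Finally, Cauchy-Schwarz for df gives h ≤ g ≤ λ²h, which yields
positivity of h and the comparison of distances. -/

theorem contDiffAt_of_forall_apply {D F : Type*} [NormedAddCommGroup D] [NormedSpace ℝ D]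
    [NormedAddCommGroup F] [NormedSpace ℝ F] [FiniteDimensional ℝ E] {n : WithTop ℕ∞}
    {f : D → E →L[ℝ] F} {x : D}
    (h : ∀ w, ContDiffAt ℝ n (fun y => f y w) x) : ContDiffAt ℝ n f x := by
  let d := Module.finrank ℝ E
  have hd : d = Module.finrank ℝ (Fin d → ℝ) := (Module.finrank_fin_fun ℝ).symm
  let e₁ := ContinuousLinearEquiv.ofFinrankEq hd
  let e₂ := (e₁.arrowCongr (1 : F ≃L[ℝ] F)).trans (ContinuousLinearEquiv.piRing (Fin d))
  rw [← Function.id_comp f, ← e₂.symm_comp_self]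
  exact e₂.symm.contDiff.contDiffAt.comp x (contDiffAt_pi.mpr fun i => h _)

/-- `G` is a smooth field of inner products on the open set `U`. -/
structure IsCoordMetricOn (G : E → E →L[ℝ] E →L[ℝ] ℝ) (U : Set E) : Prop where
  isOpen : IsOpen U
  contDiffOn : ContDiffOn ℝ ∞ G U
  symm : ∀ x ∈ U, ∀ u v, G x u v = G x v u
  pos : ∀ x ∈ U, ∀ u, u ≠ 0 → 0 < G x u u

/-- The second covariant derivative (Hessian) of `φ` in coordinates. -/
def coordHessian (G : E → E →L[ℝ] E →L[ℝ] ℝ) (φ : E → ℝ) (x u v : E) : ℝ :=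
  fderiv ℝ (fderiv ℝ φ) x u v - fderiv ℝ φ x (christoffel G x u v)

/-- The gradient of `φ` in coordinates. -/
def coordGrad (G : E → E →L[ℝ] E →L[ℝ] ℝ) (φ : E → ℝ) (x : E) : E :=
  (G x).inverse (fderiv ℝ φ x)

theorem christoffelFirst_apply (G : E → E →L[ℝ] E →L[ℝ] ℝ) (x u v w : E) :
    christoffelFirst G x u v w =
      (fderiv ℝ G x u v w + fderiv ℝ G x v u w - fderiv ℝ G x w u v) / 2 := by
  simp [christoffelFirst]; ring

theorem isInvertible_of_posDef [FiniteDimensional ℝ E] (A : E →L[ℝ] E →L[ℝ] ℝ)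
    (hA : ∀ u, u ≠ 0 → 0 < A u u) : A.IsInvertible := by
  have hinj : Function.Injective A := by
    rw [injective_iff_map_eq_zero]
    intro u hu
    by_contra h
    have := hA u h
    simp [hu] at this
  have hdim : Module.finrank ℝ E = Module.finrank ℝ (E →L[ℝ] ℝ) := by
    rw [← (LinearMap.toContinuousLinearMap (𝕜 := ℝ) (E := E) (F' := ℝ)).finrank_eq]
    exact (Subspace.dual_finrank_eq).symm
  exact ⟨(LinearEquiv.ofInjectiveOfFinrankEq (A : E →ₗ[ℝ] E →L[ℝ] ℝ) hinj
    hdim).toContinuousLinearEquiv, rfl⟩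

variable {G : E → E →L[ℝ] E →L[ℝ] ℝ} {U : Set E} {x : E}

namespace IsCoordMetricOn

theorem contDiffAt (hG : IsCoordMetricOn G U) (hx : x ∈ U) : ContDiffAt ℝ ∞ G x :=
  hG.contDiffOn.contDiffAt (hG.isOpen.mem_nhds hx)

theorem differentiableAt (hG : IsCoordMetricOn G U) (hx : x ∈ U) : DifferentiableAt ℝ G x :=
  (hG.contDiffAt hx).differentiableAt (by simp)

theorem contDiffAt_fderiv (hG : IsCoordMetricOn G U) (hx : x ∈ U) :
    ContDiffAt ℝ ∞ (fderiv ℝ G) x :=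
  (hG.contDiffAt hx).fderiv_right (by simp)

theorem fderiv_apply₂ (hG : IsCoordMetricOn G U) (hx : x ∈ U) (u v w : E) :
    fderiv ℝ (fun y => G y v w) x u = fderiv ℝ G x u v w := by
  have := hG.differentiableAt hx
  rw [fderiv_clm_apply (by fun_prop) (by fun_prop), fderiv_clm_apply (by fun_prop) (by fun_prop)]
  simp

theorem fderiv_symm (hG : IsCoordMetricOn G U) (hx : x ∈ U) (u v w : E) :
    fderiv ℝ G x u v w = fderiv ℝ G x u w v := by
  rw [← hG.fderiv_apply₂ hx, ← hG.fderiv_apply₂ hx]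
  congr 1
  apply Filter.EventuallyEq.fderiv_eq
  filter_upwards [hG.isOpen.mem_nhds hx] with y hy using hG.symm y hy v w

variable [FiniteDimensional ℝ E]

theorem isInvertible (hG : IsCoordMetricOn G U) (hx : x ∈ U) : (G x).IsInvertible :=
  isInvertible_of_posDef _ (hG.pos x hx)

theorem apply_inverse (hG : IsCoordMetricOn G U) (hx : x ∈ U) (α : E →L[ℝ] ℝ) :
    G x ((G x).inverse α) = α := by
  rw [(hG.isInvertible hx).self_apply_inverse]

theorem inverse_eq (hG : IsCoordMetricOn G U) (hx : x ∈ U) {α : E →L[ℝ] ℝ} {u : E}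
    (h : ∀ w, G x u w = α w) : (G x).inverse α = u := by
  rw [(hG.isInvertible hx).inverse_apply_eq]
  ext w; exact (h w).symm

theorem ext_left (hG : IsCoordMetricOn G U) (hx : x ∈ U) {u v : E}
    (h : ∀ w, G x u w = G x v w) : u = v := by
  rw [← hG.inverse_eq hx h]
  exact hG.inverse_eq hx fun _ => rfl

theorem contDiffAt_inverse (hG : IsCoordMetricOn G U) (hx : x ∈ U) :
    ContDiffAt ℝ ∞ (fun y => (G y).inverse) x := by
  obtain ⟨e, he⟩ := hG.isInvertible hx
  have := FiniteDimensional.complete ℝ E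
  have h := contDiffAt_map_inverse (𝕜 := ℝ) (n := ∞) e
  rw [he] at h
  exact h.comp x (hG.contDiffAt hx)

theorem apply_christoffel (hG : IsCoordMetricOn G U) (hx : x ∈ U) (u v w : E) :
    G x (christoffel G x u v) w =
      (fderiv ℝ G x u v w + fderiv ℝ G x v u w - fderiv ℝ G x w u v) / 2 := by
  rw [christoffel, hG.apply_inverse hx, christoffelFirst_apply]

theorem christoffel_symm (hG : IsCoordMetricOn G U) (hx : x ∈ U) (u v : E) :
    christoffel G x u v = christoffel G x v u := by
  apply hG.ext_left hx
  intro w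
  rw [hG.apply_christoffel hx, hG.apply_christoffel hx, hG.fderiv_symm hx w u v]
  ring

/-- The Levi-Civita connection is compatible with the metric. -/
theorem fderiv_eq_christoffel (hG : IsCoordMetricOn G U) (hx : x ∈ U) (u v w : E) :
    fderiv ℝ G x u v w = G x (christoffel G x u v) w + G x v (christoffel G x u w) := by
  rw [hG.symm x hx v, hG.apply_christoffel hx, hG.apply_christoffel hx, hG.fderiv_symm hx u w v]
  ring

theorem christoffel_add_right (hG : IsCoordMetricOn G U) (hx : x ∈ U) (u v w : E) :
    christoffel G x u (v + w) = christoffel G x u v + christoffel G x u w := by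
  apply hG.ext_left hx
  intro z
  simp only [map_add, add_apply, hG.apply_christoffel hx]
  ring

theorem christoffel_smul_right (hG : IsCoordMetricOn G U) (hx : x ∈ U) (a : ℝ) (u v : E) :
    christoffel G x u (a • v) = a • christoffel G x u v := by
  apply hG.ext_left hx
  intro z
  simp only [map_smul, smul_apply, hG.apply_christoffel hx, smul_eq_mul]
  ring

/-- Joint smoothness in position and velocity is what the existence theorem for the geodesic
equation requires. -/
theorem contDiffAt_christoffel (hG : IsCoordMetricOn G U) {y : E} (hx : x ∈ U) :
    ContDiffAt ℝ ∞ (fun p : E × E => christoffel G p.1 p.2 p.2) (x, y) := by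
  have hfst : ContDiffAt ℝ ∞ (fun p : E × E => p.1) (x, y) := contDiffAt_fst
  have hsnd : ContDiffAt ℝ ∞ (fun p : E × E => p.2) (x, y) := contDiffAt_snd
  have h1 : ContDiffAt ℝ ∞ (fun p : E × E => fderiv ℝ G p.1) (x, y) :=
    ContDiffAt.comp (x, y) (hG.contDiffAt_fderiv hx) hfst
  have h2 : ContDiffAt ℝ ∞ (fun p : E × E => (G p.1).inverse) (x, y) :=
    ContDiffAt.comp (x, y) (hG.contDiffAt_inverse hx) hfst
  refine h2.clm_apply ?_
  refine contDiffAt_of_forall_apply fun w => ?_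
  simp only [christoffelFirst_apply]
  have h3 := (h1.clm_apply hsnd).clm_apply hsnd
  have h4 := ((h1.clm_apply (contDiffAt_const (c := w))).clm_apply hsnd).clm_apply hsnd
  have h5 := h3.clm_apply (contDiffAt_const (c := w))
  exact ((h5.add h5).sub h4).div_const 2

theorem contDiffAt_christoffel_const (hG : IsCoordMetricOn G U) (hx : x ∈ U) (u v : E) :
    ContDiffAt ℝ ∞ (fun y => christoffel G y u v) x := by
  refine (hG.contDiffAt_inverse hx).clm_apply ?_
  refine contDiffAt_of_forall_apply fun w => ?_
  simp only [christoffelFirst_apply]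
  have h (a b c : E) : ContDiffAt ℝ ∞ (fun y => fderiv ℝ G y a b c) x :=
    (((hG.contDiffAt_fderiv hx).clm_apply contDiffAt_const).clm_apply
      contDiffAt_const).clm_apply contDiffAt_const
  exact (((h _ _ _).add (h _ _ _)).sub (h _ _ _)).div_const 2

theorem differentiableAt_christoffel (hG : IsCoordMetricOn G U) (hx : x ∈ U) (u v : E) :
    DifferentiableAt ℝ (fun y => christoffel G y u v) x :=
  (hG.contDiffAt_christoffel_const hx u v).differentiableAt (by simp)

end IsCoordMetricOn

end CoordinateGeometry

/-! ### Connection and curvature of the stretched metric -/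

section StretchedCurvature

variable {E : Type*} [NormedAddCommGroup E] [NormedSpace ℝ E] [FiniteDimensional ℝ E]
  {G Gh : E → E →L[ℝ] E →L[ℝ] ℝ} {U : Set E} {x : E} {φ : E → ℝ} {l : ℝ}

theorem isSymmSndFDerivAt_of_contDiffAt {F : Type*} [NormedAddCommGroup F] [NormedSpace ℝ F]
    {f : E → F} (h : ContDiffAt ℝ ∞ f x) (u v : E) :
    fderiv ℝ (fderiv ℝ f) x u v = fderiv ℝ (fderiv ℝ f) x v u :=
  h.isSymmSndFDerivAt
    (by rw [minSmoothness_of_isRCLikeNormedField]; exact WithTop.coe_le_coe.mpr le_top) u v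

namespace IsCoordMetricOn

theorem fderiv_apply_christoffel (hG : IsCoordMetricOn G U) (hx : x ∈ U) (u v w z : E) :
    fderiv ℝ (fun y => G y (christoffel G y v w) z) x u =
      fderiv ℝ G x u (christoffel G x v w) z
        + G x (fderiv ℝ (fun y => christoffel G y v w) x u) z := by
  have h1 := hG.differentiableAt hx
  have h2 := hG.differentiableAt_christoffel hx v w
  rw [fderiv_clm_apply (by fun_prop) (by fun_prop), fderiv_clm_apply (by fun_prop) (by fun_prop)]
  simp [add_comm]

/-- The curvature operator `R(u, v)` is skew with respect to the metric. -/
theorem apply_riemannTensor_self (hG : IsCoordMetricOn G U) (hx : x ∈ U) (u v w : E) :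
    G x (riemannTensor G x u v w) w = 0 := by
  -- This is the derivative in direction a of metric compatibility, D_b G(w, w) = 2 G(Γ(b, w), w).
  -- Antisymmetrized in a and b, the left side vanishes because second derivatives of G commute, and
  -- the right side becomes 2 G(R(a, b)w, w).
  have key (a b : E) : fderiv ℝ (fderiv ℝ G) x a b w w =
      2 * (fderiv ℝ G x a (christoffel G x b w) w
        + G x (fderiv ℝ (fun y => christoffel G y b w) x a) w) := by
    rw [← hG.fderiv_apply_christoffel hx]
    have h1 : fderiv ℝ (fun y => fderiv ℝ G y b w w) x a = fderiv ℝ (fderiv ℝ G) x a b w w := by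
      have := (hG.contDiffAt_fderiv hx).differentiableAt (by simp)
      rw [fderiv_clm_apply (by fun_prop) (by fun_prop),
        fderiv_clm_apply (by fun_prop) (by fun_prop),
        fderiv_clm_apply (by fun_prop) (by fun_prop)]
      simp
    have h2 : (fun y => fderiv ℝ G y b w w) =ᶠ[𝓝 x]
        fun y => 2 * G y (christoffel G y b w) w := by
      filter_upwards [hG.isOpen.mem_nhds hx] with y hy
      rw [hG.fderiv_eq_christoffel hy, hG.symm y hy w]; ring
    have h3 := hG.differentiableAt hx
    have h4 := hG.differentiableAt_christoffel hx b w
    rw [← h1, h2.fderiv_eq, fderiv_const_mul (by fun_prop)]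
    simp
  have hsymm := congrArg (fun A => A w w)
    (isSymmSndFDerivAt_of_contDiffAt (hG.contDiffAt hx) u v)
  simp only [key, hG.fderiv_eq_christoffel hx] at hsymm
  rw [hG.symm x hx (christoffel G x v w) (christoffel G x u w)] at hsymm
  simp only [riemannTensor, map_add, map_sub, add_apply, sub_apply]
  linarith

end IsCoordMetricOn

/-- `φ` is a smooth function on `U` whose `G`-gradient has norm one. -/
structure IsUnitGradientOn (G : E → E →L[ℝ] E →L[ℝ] ℝ) (φ : E → ℝ) (U : Set E) : Prop where
  contDiffOn : ContDiffOn ℝ ∞ φ U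
  apply_grad : ∀ x ∈ U, fderiv ℝ φ x (coordGrad G φ x) = 1

/-- `Gh` is the metric `G - (1 - l⁻²) dφ ⊗ dφ` on `U`. -/
def IsCoordStretchOn (G Gh : E → E →L[ℝ] E →L[ℝ] ℝ) (φ : E → ℝ) (l : ℝ) (U : Set E) : Prop :=
  ∀ x ∈ U, ∀ u v, Gh x u v = G x u v - (1 - (l ^ 2)⁻¹) * (fderiv ℝ φ x u * fderiv ℝ φ x v)

theorem contDiffAt_fderiv_of_infty {F : Type*} [NormedAddCommGroup F] [NormedSpace ℝ F]
    {f : E → F} (h : ContDiffAt ℝ ∞ f x) : ContDiffAt ℝ ∞ (fderiv ℝ f) x :=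
  h.fderiv_right (by simp)

theorem fderiv_fderiv_apply {f : E → ℝ} (h : ContDiffAt ℝ ∞ f x) (u v : E) :
    fderiv ℝ (fun y => fderiv ℝ f y v) x u = fderiv ℝ (fderiv ℝ f) x u v := by
  have := (contDiffAt_fderiv_of_infty h).differentiableAt (by simp)
  rw [fderiv_clm_apply (by fun_prop) (by fun_prop)]
  simp

namespace IsUnitGradientOn

theorem contDiffAt (hφ : IsUnitGradientOn G φ U) (hG : IsCoordMetricOn G U) (hx : x ∈ U) :
    ContDiffAt ℝ ∞ φ x :=
  hφ.contDiffOn.contDiffAt (hG.isOpen.mem_nhds hx)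

theorem contDiffAt_grad (hφ : IsUnitGradientOn G φ U) (hG : IsCoordMetricOn G U) (hx : x ∈ U) :
    ContDiffAt ℝ ∞ (coordGrad G φ) x :=
  (hG.contDiffAt_inverse hx).clm_apply (contDiffAt_fderiv_of_infty (hφ.contDiffAt hG hx))

theorem differentiableAt_grad (hφ : IsUnitGradientOn G φ U) (hG : IsCoordMetricOn G U)
    (hx : x ∈ U) : DifferentiableAt ℝ (coordGrad G φ) x :=
  (hφ.contDiffAt_grad hG hx).differentiableAt (by simp)

end IsUnitGradientOn

theorem IsCoordMetricOn.grad_apply (hG : IsCoordMetricOn G U) (hx : x ∈ U) (z : E) :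
    G x (coordGrad G φ x) z = fderiv ℝ φ x z := by
  rw [coordGrad, hG.apply_inverse hx]

theorem coordHessian_symm (hφ : IsUnitGradientOn G φ U) (hG : IsCoordMetricOn G U) (hx : x ∈ U)
    (u v : E) : coordHessian G φ x u v = coordHessian G φ x v u := by
  rw [coordHessian, coordHessian, hG.christoffel_symm hx u v,
    isSymmSndFDerivAt_of_contDiffAt (hφ.contDiffAt hG hx)]

theorem coordHessian_add_right (hG : IsCoordMetricOn G U) (hx : x ∈ U)
    (u v w : E) :
    coordHessian G φ x u (v + w) = coordHessian G φ x u v + coordHessian G φ x u w := by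
  simp only [coordHessian, hG.christoffel_add_right hx, map_add]; ring

theorem coordHessian_smul_right (hG : IsCoordMetricOn G U) (hx : x ∈ U)
    (a : ℝ) (u v : E) :
    coordHessian G φ x u (a • v) = a * coordHessian G φ x u v := by
  simp only [coordHessian, hG.christoffel_smul_right hx, map_smul, smul_eq_mul]; ring

/-- The covariant derivative of the gradient is the Hessian. -/
theorem apply_cov_grad (hφ : IsUnitGradientOn G φ U) (hG : IsCoordMetricOn G U) (hx : x ∈ U)
    (u z : E) :
    G x (fderiv ℝ (coordGrad G φ) x u + christoffel G x u (coordGrad G φ x)) z =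
      coordHessian G φ x u z := by
  have h : (fun y => G y (coordGrad G φ y) z) =ᶠ[𝓝 x] fun y => fderiv ℝ φ y z := by
    filter_upwards [hG.isOpen.mem_nhds hx] with y hy using hG.grad_apply hy z
  have h1 := congrArg (fun A : E →L[ℝ] ℝ => A u) h.fderiv_eq
  have h2 := hG.differentiableAt hx
  have h3 := hφ.differentiableAt_grad hG hx
  rw [fderiv_fderiv_apply (hφ.contDiffAt hG hx),
    fderiv_clm_apply (by fun_prop) (by fun_prop), fderiv_clm_apply (by fun_prop) (by fun_prop)]
    at h1
  simp only [fderiv_fun_const, Pi.zero_apply, ContinuousLinearMap.comp_zero, zero_add,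
    ContinuousLinearMap.flip_apply, add_apply, ContinuousLinearMap.comp_apply,
    hG.fderiv_eq_christoffel hx, hG.grad_apply hx] at h1
  rw [coordHessian, map_add, add_apply]
  linarith

/-- Differentiating dφ(N) = |N|² = 1 gives 2⟨∇_u N, N⟩ = 0. -/
theorem fderiv_apply_cov_grad (hφ : IsUnitGradientOn G φ U) (hG : IsCoordMetricOn G U)
    (hx : x ∈ U) (u : E) :
    fderiv ℝ φ x (fderiv ℝ (coordGrad G φ) x u + christoffel G x u (coordGrad G φ x)) = 0 := by
  have h : (fun y => fderiv ℝ φ y (coordGrad G φ y)) =ᶠ[𝓝 x] fun y => (1 : ℝ) := by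
    filter_upwards [hG.isOpen.mem_nhds hx] with y hy using hφ.apply_grad y hy
  have h1 := congrArg (fun A : E →L[ℝ] ℝ => A u) h.fderiv_eq
  have h2 := (contDiffAt_fderiv_of_infty (hφ.contDiffAt hG hx)).differentiableAt (by simp)
  have h3 := hφ.differentiableAt_grad hG hx
  rw [fderiv_clm_apply (by fun_prop) (by fun_prop)] at h1
  simp at h1
  have h4 := apply_cov_grad hφ hG hx u (coordGrad G φ x)
  rw [hG.symm x hx, hG.grad_apply hx, coordHessian] at h4
  rw [map_add] at h4 ⊢
  linarith

theorem coordHessian_grad (hφ : IsUnitGradientOn G φ U) (hG : IsCoordMetricOn G U)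
    (hx : x ∈ U) (u : E) : coordHessian G φ x u (coordGrad G φ x) = 0 := by
  rw [← apply_cov_grad hφ hG hx, hG.symm x hx, hG.grad_apply hx, fderiv_apply_cov_grad hφ hG hx]

theorem fderiv_stretch (hφ : IsUnitGradientOn G φ U) (hG : IsCoordMetricOn G U)
    (hGh : IsCoordMetricOn Gh U) (hs : IsCoordStretchOn G Gh φ l U) (hx : x ∈ U) (u v w : E) :
    fderiv ℝ Gh x u v w = fderiv ℝ G x u v w - (1 - (l ^ 2)⁻¹) *
      (fderiv ℝ (fderiv ℝ φ) x u v * fderiv ℝ φ x w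
        + fderiv ℝ φ x v * fderiv ℝ (fderiv ℝ φ) x u w) := by
  have h1 := hG.differentiableAt hx
  have h2 := (contDiffAt_fderiv_of_infty (hφ.contDiffAt hG hx)).differentiableAt (by simp)
  have h : (fun y => Gh y v w) =ᶠ[𝓝 x] fun y =>
      G y v w - (1 - (l ^ 2)⁻¹) * (fderiv ℝ φ y v * fderiv ℝ φ y w) := by
    filter_upwards [hG.isOpen.mem_nhds hx] with y hy using hs y hy v w
  rw [← hGh.fderiv_apply₂ hx, h.fderiv_eq, fderiv_fun_sub (by fun_prop) (by fun_prop),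
    fderiv_const_mul (by fun_prop), fderiv_fun_mul (by fun_prop) (by fun_prop)]
  simp only [sub_apply, smul_apply, add_apply, smul_eq_mul, hG.fderiv_apply₂ hx,
    fderiv_fderiv_apply (hφ.contDiffAt hG hx)]
  ring

/-- The Koszul formula applied to dφ ⊗ dφ leaves only a multiple of D²φ(u, v) dφ. Raising this
covector with `Gh` gives a multiple of N, and since Gh(N, ·) = l⁻² dφ the factor 1 - l⁻² becomes l²
- 1. -/
theorem christoffel_stretch (hφ : IsUnitGradientOn G φ U) (hG : IsCoordMetricOn G U)
    (hGh : IsCoordMetricOn Gh U) (hs : IsCoordStretchOn G Gh φ l U) (hl : l ≠ 0) (hx : x ∈ U)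
    (u v : E) :
    christoffel Gh x u v = christoffel G x u v
      - ((l ^ 2 - 1) * coordHessian G φ x u v) • coordGrad G φ x := by
  apply hGh.ext_left hx
  intro w
  rw [hGh.apply_christoffel hx, hs x hx]
  simp only [fderiv_stretch hφ hG hGh hs hx, map_sub, map_smul, sub_apply, smul_apply,
    hG.grad_apply hx, hφ.apply_grad x hx, hG.apply_christoffel hx, coordHessian, smul_eq_mul]
  rw [isSymmSndFDerivAt_of_contDiffAt (hφ.contDiffAt hG hx) w u,
    isSymmSndFDerivAt_of_contDiffAt (hφ.contDiffAt hG hx) w v,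
    isSymmSndFDerivAt_of_contDiffAt (hφ.contDiffAt hG hx) v u]
  field_simp
  ring

theorem differentiableAt_coordHessian (hφ : IsUnitGradientOn G φ U) (hG : IsCoordMetricOn G U)
    (hx : x ∈ U) (v w : E) : DifferentiableAt ℝ (fun y => coordHessian G φ y v w) x := by
  have h1 := contDiffAt_fderiv_of_infty (hφ.contDiffAt hG hx)
  have h2 := (contDiffAt_fderiv_of_infty h1).differentiableAt (by simp)
  have h3 := h1.differentiableAt (by simp)
  have h4 := hG.differentiableAt_christoffel hx v w
  unfold coordHessian
  fun_prop

/-- The Ricci identity for the differential of `φ`: the Hessian is a Codazzi tensor up to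
curvature. -/
theorem coordHessian_codazzi (hφ : IsUnitGradientOn G φ U) (hG : IsCoordMetricOn G U)
    (hx : x ∈ U) (u v w : E) :
    fderiv ℝ (fun y => coordHessian G φ y v w) x u - fderiv ℝ (fun y => coordHessian G φ y u w) x v
      + coordHessian G φ x u (christoffel G x v w) - coordHessian G φ x v (christoffel G x u w)
      = -fderiv ℝ φ x (riemannTensor G x u v w) := by
  have h1 := contDiffAt_fderiv_of_infty (hφ.contDiffAt hG hx)
  have h2 := (contDiffAt_fderiv_of_infty h1).differentiableAt (by simp)
  have h3 := h1.differentiableAt (by simp)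
  have key (a b : E) : fderiv ℝ (fun y => coordHessian G φ y b w) x a =
      fderiv ℝ (fderiv ℝ (fderiv ℝ φ)) x a b w
        - fderiv ℝ (fderiv ℝ φ) x a (christoffel G x b w)
        - fderiv ℝ φ x (fderiv ℝ (fun y => christoffel G y b w) x a) := by
    have h4 := hG.differentiableAt_christoffel hx b w
    unfold coordHessian
    rw [fderiv_fun_sub (by fun_prop) (by fun_prop), fderiv_clm_apply (by fun_prop) (by fun_prop),
      fderiv_clm_apply (by fun_prop) (by fun_prop), fderiv_clm_apply (by fun_prop) (by fun_prop)]
    simp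
    ring
  rw [key, key, isSymmSndFDerivAt_of_contDiffAt h1 u v]
  simp only [coordHessian, riemannTensor, map_add, map_sub]
  ring

/-- This is the curvature of the connection ∇ - (l² - 1) H ⊗ N. The terms in (l² - 1)² contain H(·,
N) and therefore vanish. -/
theorem riemannTensor_stretch (hφ : IsUnitGradientOn G φ U) (hG : IsCoordMetricOn G U)
    (hGh : IsCoordMetricOn Gh U) (hs : IsCoordStretchOn G Gh φ l U) (hl : l ≠ 0) (hx : x ∈ U)
    (u v w : E) :
    riemannTensor Gh x u v w = riemannTensor G x u v w
      + ((l ^ 2 - 1) * fderiv ℝ φ x (riemannTensor G x u v w)) • coordGrad G φ x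
      - ((l ^ 2 - 1) * coordHessian G φ x v w) •
          (fderiv ℝ (coordGrad G φ) x u + christoffel G x u (coordGrad G φ x))
      + ((l ^ 2 - 1) * coordHessian G φ x u w) •
          (fderiv ℝ (coordGrad G φ) x v + christoffel G x v (coordGrad G φ x)) := by
  have key (a b : E) : fderiv ℝ (fun y => christoffel Gh y b w) x a =
      fderiv ℝ (fun y => christoffel G y b w) x a
        - ((l ^ 2 - 1) * fderiv ℝ (fun y => coordHessian G φ y b w) x a) • coordGrad G φ x
        - ((l ^ 2 - 1) * coordHessian G φ x b w) • fderiv ℝ (coordGrad G φ) x a := by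
    have h1 := hG.differentiableAt_christoffel hx b w
    have h2 := hφ.differentiableAt_grad hG hx
    have h3 := differentiableAt_coordHessian hφ hG hx b w
    have h : (fun y => christoffel Gh y b w) =ᶠ[𝓝 x] fun y => christoffel G y b w
        - ((l ^ 2 - 1) * coordHessian G φ y b w) • coordGrad G φ y := by
      filter_upwards [hG.isOpen.mem_nhds hx] with y hy using
        christoffel_stretch hφ hG hGh hs hl hy b w
    rw [h.fderiv_eq, fderiv_fun_sub (by fun_prop) (by fun_prop),
      fderiv_fun_smul (by fun_prop) (by fun_prop), fderiv_const_mul (by fun_prop)]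
    simp
    abel
  -- The Ricci identity is read backwards: dφ(R(u, v)w) on the right is replaced by the
  -- antisymmetrized derivatives of the Hessian that `key` produces on the left.
  rw [← neg_eq_iff_eq_neg.mpr (coordHessian_codazzi hφ hG hx u v w)]
  conv_lhs => rw [riemannTensor, key, key]
  simp only [christoffel_stretch hφ hG hGh hs hl hx, hG.christoffel_smul_right hx,
    sub_eq_add_neg, coordHessian_add_right hG hx, ← neg_smul,
    hG.christoffel_add_right hx,
    coordHessian_smul_right hG hx, coordHessian_grad hφ hG hx]
  rw [riemannTensor]
  module

/-- The Gauss type formula for the curvature of the stretched metric. -/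
theorem apply_riemannTensor_stretch (hφ : IsUnitGradientOn G φ U) (hG : IsCoordMetricOn G U)
    (hGh : IsCoordMetricOn Gh U) (hs : IsCoordStretchOn G Gh φ l U) (hl : l ≠ 0) (hx : x ∈ U)
    (u v w z : E) :
    Gh x (riemannTensor Gh x u v w) z = G x (riemannTensor G x u v w) z - (l ^ 2 - 1) *
      (coordHessian G φ x v w * coordHessian G φ x u z
        - coordHessian G φ x u w * coordHessian G φ x v z) := by
  rw [riemannTensor_stretch hφ hG hGh hs hl hx, hs x hx]
  have h1 := fderiv_apply_cov_grad hφ hG hx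
  have h2 := apply_cov_grad hφ hG hx
  generalize hA : fderiv ℝ (coordGrad G φ) x u + christoffel G x u (coordGrad G φ x) = A at *
  generalize hB : fderiv ℝ (coordGrad G φ) x v + christoffel G x v (coordGrad G φ x) = B at *
  have h1u := h1 u; have h1v := h1 v; have h2u := h2 u z; have h2v := h2 v z
  rw [hA] at h1u h2u
  rw [hB] at h1v h2v
  -- The covariant derivatives of N lie in ker dφ, where `Gh` agrees with `G`. As Gh(N, z) = l⁻²
  -- dφ(z), the N-component of the curvature contributes (1 - l⁻²) dφ(R(u, v)w) dφ(z), which cancels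
  -- the correction in Gh(R(u, v)w, z).
  simp only [map_add, map_sub, map_smul, add_apply, sub_apply, smul_apply, smul_eq_mul,
    hG.grad_apply hx, hφ.apply_grad x hx, h1u, h1v, h2u, h2v]
  field_simp
  ring

end StretchedCurvature

/-! ### Algebra of sectional curvature and the pinching estimate -/

section Pinching

variable {E : Type*} [NormedAddCommGroup E] [NormedSpace ℝ E] [FiniteDimensional ℝ E]
  {G Gh : E → E →L[ℝ] E →L[ℝ] ℝ} {U : Set E} {x : E} {φ : E → ℝ} {l : ℝ}

theorem riemannTensor_swap (G : E → E →L[ℝ] E →L[ℝ] ℝ) (x u v w : E) :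
    riemannTensor G x v u w = -riemannTensor G x u v w := by
  simp only [riemannTensor]; abel

namespace IsCoordMetricOn

theorem christoffel_add_left (hG : IsCoordMetricOn G U) (hx : x ∈ U) (u v w : E) :
    christoffel G x (u + v) w = christoffel G x u w + christoffel G x v w := by
  rw [hG.christoffel_symm hx, hG.christoffel_add_right hx, hG.christoffel_symm hx w u,
    hG.christoffel_symm hx w v]

theorem christoffel_smul_left (hG : IsCoordMetricOn G U) (hx : x ∈ U) (a : ℝ) (u w : E) :
    christoffel G x (a • u) w = a • christoffel G x u w := by
  rw [hG.christoffel_symm hx, hG.christoffel_smul_right hx, hG.christoffel_symm hx w u]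

theorem fderiv_christoffel_add_left (hG : IsCoordMetricOn G U) (hx : x ∈ U) (u v w z : E) :
    fderiv ℝ (fun y => christoffel G y (u + v) w) x z =
      fderiv ℝ (fun y => christoffel G y u w) x z
        + fderiv ℝ (fun y => christoffel G y v w) x z := by
  have h : (fun y => christoffel G y (u + v) w) =ᶠ[𝓝 x]
      fun y => christoffel G y u w + christoffel G y v w := by
    filter_upwards [hG.isOpen.mem_nhds hx] with y hy using hG.christoffel_add_left hy u v w
  rw [h.fderiv_eq, fderiv_fun_add (hG.differentiableAt_christoffel hx u w)
    (hG.differentiableAt_christoffel hx v w)]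
  rfl

theorem fderiv_christoffel_smul_left (hG : IsCoordMetricOn G U) (hx : x ∈ U) (a : ℝ)
    (u w z : E) :
    fderiv ℝ (fun y => christoffel G y (a • u) w) x z =
      a • fderiv ℝ (fun y => christoffel G y u w) x z := by
  have h : (fun y => christoffel G y (a • u) w) =ᶠ[𝓝 x] fun y => a • christoffel G y u w := by
    filter_upwards [hG.isOpen.mem_nhds hx] with y hy using hG.christoffel_smul_left hy a u w
  rw [h.fderiv_eq, fderiv_fun_const_smul (hG.differentiableAt_christoffel hx u w)]
  rfl

theorem riemannTensor_add_left (hG : IsCoordMetricOn G U) (hx : x ∈ U) (u u' v w : E) :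
    riemannTensor G x (u + u') v w = riemannTensor G x u v w + riemannTensor G x u' v w := by
  simp only [riemannTensor, map_add, hG.fderiv_christoffel_add_left hx,
    hG.christoffel_add_left hx, hG.christoffel_add_right hx]
  abel

theorem riemannTensor_smul_left (hG : IsCoordMetricOn G U) (hx : x ∈ U) (a : ℝ) (u v w : E) :
    riemannTensor G x (a • u) v w = a • riemannTensor G x u v w := by
  simp only [riemannTensor, map_smul, hG.fderiv_christoffel_smul_left hx,
    hG.christoffel_smul_left hx, hG.christoffel_smul_right hx]
  module

theorem riemannTensor_add_right (hG : IsCoordMetricOn G U) (hx : x ∈ U) (u v w w' : E) :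
    riemannTensor G x u v (w + w') = riemannTensor G x u v w + riemannTensor G x u v w' := by
  have h (a b : E) : fderiv ℝ (fun y => christoffel G y a (w + w')) x b =
      fderiv ℝ (fun y => christoffel G y a w) x b
        + fderiv ℝ (fun y => christoffel G y a w') x b := by
    have h : (fun y => christoffel G y a (w + w')) =ᶠ[𝓝 x]
        fun y => christoffel G y a w + christoffel G y a w' := by
      filter_upwards [hG.isOpen.mem_nhds hx] with y hy using hG.christoffel_add_right hy a w w'
    rw [h.fderiv_eq, fderiv_fun_add (hG.differentiableAt_christoffel hx a w)
      (hG.differentiableAt_christoffel hx a w')]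
    rfl
  simp only [riemannTensor, h, hG.christoffel_add_right hx]
  abel

theorem riemannTensor_smul_right (hG : IsCoordMetricOn G U) (hx : x ∈ U) (a : ℝ) (u v w : E) :
    riemannTensor G x u v (a • w) = a • riemannTensor G x u v w := by
  have h (b c : E) : fderiv ℝ (fun y => christoffel G y b (a • w)) x c =
      a • fderiv ℝ (fun y => christoffel G y b w) x c := by
    have h : (fun y => christoffel G y b (a • w)) =ᶠ[𝓝 x]
        fun y => a • christoffel G y b w := by
      filter_upwards [hG.isOpen.mem_nhds hx] with y hy using hG.christoffel_smul_right hy a b w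
    rw [h.fderiv_eq, fderiv_fun_const_smul (hG.differentiableAt_christoffel hx b w)]
    rfl
  simp only [riemannTensor, h, hG.christoffel_smul_right hx]
  module

theorem riemannTensor_self (G : E → E →L[ℝ] E →L[ℝ] ℝ) (x u w : E) :
    riemannTensor G x u u w = 0 := by
  simp only [riemannTensor]; abel

theorem apply_riemannTensor_skew (hG : IsCoordMetricOn G U) (hx : x ∈ U) (u v w z : E) :
    G x (riemannTensor G x u v w) z = -G x (riemannTensor G x u v z) w := by
  have h := hG.apply_riemannTensor_self hx u v (w + z)
  simp only [hG.riemannTensor_add_right hx, map_add, add_apply,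
    hG.apply_riemannTensor_self hx] at h
  linarith

theorem riemannTensor_change_basis (hG : IsCoordMetricOn G U) (hx : x ∈ U) (u v w : E)
    (a b c d : ℝ) :
    riemannTensor G x (a • u + b • v) (c • u + d • v) w =
      (a * d - b * c) • riemannTensor G x u v w := by
  have h (z : E) : riemannTensor G x z (c • u + d • v) w =
      c • riemannTensor G x z u w + d • riemannTensor G x z v w := by
    rw [riemannTensor_swap, hG.riemannTensor_add_left hx, hG.riemannTensor_smul_left hx,
      hG.riemannTensor_smul_left hx, riemannTensor_swap G x z u, riemannTensor_swap G x z v]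
    module
  rw [hG.riemannTensor_add_left hx, hG.riemannTensor_smul_left hx, hG.riemannTensor_smul_left hx,
    h, h, riemannTensor_self, riemannTensor_self, riemannTensor_swap G x u v]
  module

/-- The sectional curvature depends only on the plane. -/
theorem coordSectionalCurvature_change_basis (hG : IsCoordMetricOn G U) (hx : x ∈ U) (u v : E)
    (a b c d : ℝ) (h : a * d - b * c ≠ 0) :
    coordSectionalCurvature G x (a • u + b • v) (c • u + d • v) =
      coordSectionalCurvature G x u v := by
  have h1 : G x (riemannTensor G x (a • u + b • v) (c • u + d • v) (c • u + d • v))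
      (a • u + b • v) = (a * d - b * c) ^ 2 * G x (riemannTensor G x u v v) u := by
    rw [hG.riemannTensor_change_basis hx, hG.riemannTensor_add_right hx,
      hG.riemannTensor_smul_right hx, hG.riemannTensor_smul_right hx]
    simp only [map_add, map_smul, add_apply, smul_apply, smul_eq_mul,
      hG.apply_riemannTensor_self hx, hG.apply_riemannTensor_skew hx u v u v]
    ring
  have h2 : G x (a • u + b • v) (a • u + b • v) * G x (c • u + d • v) (c • u + d • v)
      - G x (a • u + b • v) (c • u + d • v) ^ 2 =
      (a * d - b * c) ^ 2 * (G x u u * G x v v - G x u v ^ 2) := by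
    simp only [map_add, map_smul, add_apply, smul_apply, smul_eq_mul, hG.symm x hx v u]
    ring
  rw [coordSectionalCurvature, coordSectionalCurvature, h1, h2,
    mul_div_mul_left _ _ (pow_ne_zero 2 h)]

theorem nonneg (hG : IsCoordMetricOn G U) (hx : x ∈ U) (u : E) : 0 ≤ G x u u := by
  rcases eq_or_ne u 0 with rfl | h
  · simp
  · exact (hG.pos x hx u h).le

theorem linearIndependent_of_orthogonal (hG : IsCoordMetricOn G U) (hx : x ∈ U) {u v : E}
    (hu : u ≠ 0) (hv : v ≠ 0) (h : G x u v = 0) : LinearIndependent ℝ ![u, v] := by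
  rw [LinearIndependent.pair_iff]
  intro s t hst
  have h1 : G x (s • u + t • v) u = 0 := by simp [hst]
  have h2 : G x (s • u + t • v) v = 0 := by simp [hst]
  simp only [map_add, map_smul, add_apply, smul_apply, smul_eq_mul, hG.symm x hx v u, h] at h1 h2
  have := hG.pos x hx u hu
  have := hG.pos x hx v hv
  constructor
  · simpa [this.ne', (hG.pos x hx u hu).ne'] using h1
  · simpa [this.ne'] using h2

/-- Every plane has a `G`-orthogonal basis whose second vector is annihilated by a given
covector. -/
theorem exists_adapted_basis (hG : IsCoordMetricOn G U) (hx : x ∈ U) (α : E →L[ℝ] ℝ) {u v : E}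
    (h : LinearIndependent ℝ ![u, v]) :
    ∃ a b c d : ℝ, a * d - b * c ≠ 0 ∧ α (c • u + d • v) = 0 ∧ c • u + d • v ≠ 0 ∧
      a • u + b • v ≠ 0 ∧ G x (a • u + b • v) (c • u + d • v) = 0 := by
  have hli := LinearIndependent.pair_iff.1 h
  obtain ⟨a, b, c, d, hdet, hα⟩ : ∃ a b c d : ℝ, a * d - b * c ≠ 0 ∧ α (c • u + d • v) = 0 := by
    by_cases h0 : α u = 0 ∧ α v = 0
    · exact ⟨1, 0, 0, 1, by simp, by simp [h0.2]⟩
    -- The vector α(v)u - α(u)v lies in ker α; this choice of the other row makes the determinant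
    -- -(α(u)² + α(v)²).
    · refine ⟨α u, α v, α v, -α u, ?_, by simp; ring⟩
      intro h1
      apply h0
      constructor <;> nlinarith [sq_nonneg (α u), sq_nonneg (α v)]
  have hne : c • u + d • v ≠ 0 := by
    intro h1
    obtain ⟨rfl, rfl⟩ := hli c d h1
    simp at hdet
  have hpos := hG.pos x hx _ hne
  -- Gram-Schmidt: subtracting r times the second row from the first keeps the determinant and makes
  -- the basis orthogonal.
  set r := G x (a • u + b • v) (c • u + d • v) / G x (c • u + d • v) (c • u + d • v) with hr
  refine ⟨a - r * c, b - r * d, c, d, by convert hdet using 1; ring, hα, hne, ?_, ?_⟩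
  · intro h1
    obtain ⟨h2, h3⟩ := hli _ _ h1
    apply hdet
    linear_combination d * h2 - c * h3
  · have : (a - r * c) • u + (b - r * d) • v = (a • u + b • v) - r • (c • u + d • v) := by
      module
    rw [this, map_sub, map_smul, sub_apply, smul_apply, hr, smul_eq_mul]
    field_simp
    ring

end IsCoordMetricOn

variable {Λ δ c₁ c₂ : ℝ}

/-- Gram determinant bounds for the Hessian on orthogonal vectors tangent to the level. -/
theorem coordHessian_gram_bounds (hφ : IsUnitGradientOn G φ U) (hG : IsCoordMetricOn G U)
    (hx : x ∈ U) (hc₁ : 0 < c₁) (hc : c₁ ≤ c₂)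
    (hH : ∀ u, fderiv ℝ φ x u = 0 →
      c₁ * G x u u ≤ coordHessian G φ x u u ∧ coordHessian G φ x u u ≤ c₂ * G x u u)
    {v w : E} (hv : fderiv ℝ φ x v = 0) (hw : fderiv ℝ φ x w = 0) (hvw : G x v w = 0) :
    c₁ ^ 2 * (G x v v * G x w w) ≤ coordHessian G φ x v v * coordHessian G φ x w w
        - coordHessian G φ x v w ^ 2 ∧
      coordHessian G φ x v v * coordHessian G φ x w w - coordHessian G φ x v w ^ 2 ≤
        c₂ ^ 2 * (G x v v * G x w w) := by
  obtain ⟨hv1, hv2⟩ := hH v hv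
  obtain ⟨hw1, hw2⟩ := hH w hw
  have hV := hG.nonneg hx v
  have hW := hG.nonneg hx w
  -- The form H - c₁G is nonnegative on v + tw, and G(v, w) = 0 removes the mixed term of G. The
  -- discriminant then gives H(v,w)² ≤ (H(v,v) - c₁|v|²)(H(w,w) - c₁|w|²), from which the lower
  -- bound follows by expanding.
  have hquad (t : ℝ) : 0 ≤ (coordHessian G φ x w w - c₁ * G x w w) * (t * t)
      + (2 * coordHessian G φ x v w) * t + (coordHessian G φ x v v - c₁ * G x v v) := by
    have h := (hH (v + t • w) (by simp [hv, hw])).1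
    have hwv : G x w v = 0 := by rw [hG.symm x hx, hvw]
    rw [coordHessian_add_right hG hx, coordHessian_symm hφ hG hx (v + t • w),
      coordHessian_add_right hG hx, coordHessian_symm hφ hG hx (v + t • w),
      coordHessian_add_right hG hx] at h
    simp only [coordHessian_smul_right hG hx, coordHessian_symm hφ hG hx (t • w), map_add,
      map_smul, add_apply, smul_apply, smul_eq_mul, hvw, hwv] at h
    linarith
  have hdisc := discrim_le_zero hquad
  rw [discrim] at hdisc
  have hc₁V := mul_nonneg hc₁.le hV
  have hc₁W := mul_nonneg hc₁.le hW
  constructor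
  · nlinarith [mul_le_mul_of_nonneg_left hw1 hc₁V, mul_le_mul_of_nonneg_left hv1 hc₁W]
  · have h1 : coordHessian G φ x v v * coordHessian G φ x w w ≤
        (c₂ * G x v v) * (c₂ * G x w w) :=
      mul_le_mul hv2 hw2 (hc₁W.trans hw1) (mul_nonneg (hc₁.le.trans hc) hV)
    nlinarith [sq_nonneg (coordHessian G φ x v w)]

/-- Allowing z = 0 lets the bound be applied to sN + rw without excluding degenerate cases. -/
theorem abs_apply_riemannTensor_le (hG : IsCoordMetricOn G U) (hx : x ∈ U)
    (hK : ∀ u v, LinearIndependent ℝ ![u, v] → |coordSectionalCurvature G x u v| ≤ Λ)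
    {z v : E} (hv : v ≠ 0) (hzv : G x z v = 0) :
    |G x (riemannTensor G x z v v) z| ≤ Λ * (G x z z * G x v v) := by
  rcases eq_or_ne z 0 with rfl | hz
  · simp
  · have h := hK z v (hG.linearIndependent_of_orthogonal hx hz hv hzv)
    have hpos := mul_pos (hG.pos x hx z hz) (hG.pos x hx v hv)
    rw [coordSectionalCurvature, hzv, zero_pow two_ne_zero, sub_zero, abs_div, abs_of_pos hpos,
      div_le_iff₀ hpos] at h
    exact h

/-- Upper curvature estimate for `G` on the plane spanned by `s grad φ + w` and `v`. -/
theorem apply_riemannTensor_le (hφ : IsUnitGradientOn G φ U) (hG : IsCoordMetricOn G U)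
    (hx : x ∈ U)
    (hK : ∀ u v, LinearIndependent ℝ ![u, v] → |coordSectionalCurvature G x u v| ≤ Λ)
    (hKg : ∀ u v, LinearIndependent ℝ ![u, v] → coordGrad G φ x ∈ Submodule.span ℝ {u, v} →
      coordSectionalCurvature G x u v < -δ)
    {v w : E} (s : ℝ) {t : ℝ} (ht : 0 < t) (hv0 : v ≠ 0) (hv : fderiv ℝ φ x v = 0)
    (hw : fderiv ℝ φ x w = 0) (hwv : G x w v = 0) :
    G x (riemannTensor G x (s • coordGrad G φ x + w) v v) (s • coordGrad G φ x + w) ≤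
      (-δ * s ^ 2 + Λ / t * s ^ 2 + (Λ * t + Λ) * G x w w) * G x v v := by
  set N := coordGrad G φ x with hN
  have hNN : G x N N = 1 := by rw [hN, hG.grad_apply hx, hφ.apply_grad x hx]
  have hN0 : N ≠ 0 := by intro h; simp [h] at hNN
  have hNv : G x N v = 0 := by rw [hN, hG.grad_apply hx, hv]
  have hNw : G x N w = 0 := by rw [hN, hG.grad_apply hx, hw]
  have hwN : G x w N = 0 := by rw [hG.symm x hx, hNw]
  have hV := hG.pos x hx v hv0
  have hKN : G x (riemannTensor G x N v v) N ≤ -δ * G x v v := by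
    have h := hKg N v (hG.linearIndependent_of_orthogonal hx hN0 hv0 hNv)
      (Submodule.subset_span (by simp))
    rw [coordSectionalCurvature, hNv, hNN, one_mul, zero_pow two_ne_zero, sub_zero,
      div_lt_iff₀ hV] at h
    exact h.le
  have hexp (r : ℝ) : G x (riemannTensor G x (s • N + r • w) v v) (s • N + r • w) =
      s ^ 2 * G x (riemannTensor G x N v v) N
        + r * (s * (G x (riemannTensor G x N v v) w + G x (riemannTensor G x w v v) N))
        + r ^ 2 * G x (riemannTensor G x w v v) w := by
    simp only [hG.riemannTensor_add_left hx, hG.riemannTensor_smul_left hx, map_add, map_smul,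
      add_apply, smul_apply, smul_eq_mul]
    ring
  have hgram (r : ℝ) : G x (s • N + r • w) (s • N + r • w) = s ^ 2 + r ^ 2 * G x w w := by
    simp only [map_add, map_smul, add_apply, smul_apply, smul_eq_mul, hNN, hNw, hwN]
    ring
  have hbd (r : ℝ) := abs_le.1 (abs_apply_riemannTensor_le hG hx hK (z := s • N + r • w) hv0
    (by simp [hNv, hwv]))
  have h1 := hbd t
  have h2 := hbd (-t)
  have h3 := abs_le.1 (abs_apply_riemannTensor_le hG hx hK hv0 hwv)
  rw [hexp, hgram] at h1 h2
  have hone := hexp 1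
  rw [one_smul] at hone
  rw [hone]
  set X := s * (G x (riemannTensor G x N v v) w + G x (riemannTensor G x w v v) N)
  -- Polarization: replacing t by -t in sN + tw only reverses the sign of tX in the numerator and
  -- leaves the Gram term unchanged. Subtracting the two bounds isolates 2tX, and dividing by 2t
  -- weights the s² part by 1/t and the |w|² part by t.
  have hX : X ≤ Λ / t * s ^ 2 * G x v v + Λ * t * G x w w * G x v v := by
    have : t * X ≤ t * (Λ / t * s ^ 2 * G x v v + Λ * t * G x w w * G x v v) := by
      have : t * (Λ / t * s ^ 2 * G x v v + Λ * t * G x w w * G x v v) =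
          Λ * ((s ^ 2 + t ^ 2 * G x w w) * G x v v) := by
        field_simp
      rw [this]
      nlinarith [h1.2, h2.1]
    exact le_of_mul_le_mul_left this ht
  nlinarith [mul_le_mul_of_nonneg_left hKN (sq_nonneg s), h3.2]

/-- The curvature of the stretched metric is negatively pinched. -/
theorem coordSectionalCurvature_stretch_bounds (hφ : IsUnitGradientOn G φ U)
    (hG : IsCoordMetricOn G U) (hGh : IsCoordMetricOn Gh U) (hs : IsCoordStretchOn G Gh φ l U)
    (hx : x ∈ U) (hΛ : 0 ≤ Λ) (hδ : 0 < δ) (hc₁ : 0 < c₁) (hc : c₁ ≤ c₂)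
    (hK : ∀ u v, LinearIndependent ℝ ![u, v] → |coordSectionalCurvature G x u v| ≤ Λ)
    (hKg : ∀ u v, LinearIndependent ℝ ![u, v] → coordGrad G φ x ∈ Submodule.span ℝ {u, v} →
      coordSectionalCurvature G x u v < -δ)
    (hH : ∀ u, fderiv ℝ φ x u = 0 →
      c₁ * G x u u ≤ coordHessian G φ x u u ∧ coordHessian G φ x u u ≤ c₂ * G x u u)
    (hl1 : 1 ≤ l) (hl : Λ * (2 * Λ / δ + 1) + Λ + 1 ≤ (l ^ 2 - 1) * c₁ ^ 2)
    {u v : E} (huv : LinearIndependent ℝ ![u, v]) :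
    -(Λ * l ^ 2 + (l ^ 2 - 1) * c₂ ^ 2) ≤ coordSectionalCurvature Gh x u v ∧
      coordSectionalCurvature Gh x u v ≤ -min (δ / 2) 1 := by
  have hl0 : l ≠ 0 := by positivity
  obtain ⟨a, b, c, d, hdet, hv, hv0, hu0, horth⟩ :=
    hG.exists_adapted_basis hx (fderiv ℝ φ x) huv
  rw [← hGh.coordSectionalCurvature_change_basis hx u v a b c d hdet]
  generalize a • u + b • v = u' at hu0 horth ⊢
  generalize c • u + d • v = v' at hv hv0 horth ⊢
  set N := coordGrad G φ x with hN
  obtain ⟨s, hs'⟩ : ∃ s, s = fderiv ℝ φ x u' := ⟨_, rfl⟩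
  obtain ⟨w, rfl⟩ : ∃ w, u' = s • N + w := ⟨u' - s • N, by abel⟩
  have hNN : fderiv ℝ φ x N = 1 := hφ.apply_grad x hx
  have hw : fderiv ℝ φ x w = 0 := by
    have := hs'
    rw [map_add, map_smul, hNN, smul_eq_mul, mul_one] at this
    linarith
  have hNv : G x N v' = 0 := by rw [hN, hG.grad_apply hx, hv]
  have hNw : G x N w = 0 := by rw [hN, hG.grad_apply hx, hw]
  have hwN : G x w N = 0 := by rw [hG.symm x hx, hNw]
  have hGNN : G x N N = 1 := by rw [hN, hG.grad_apply hx, hφ.apply_grad x hx]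
  have hwv : G x w v' = 0 := by
    rw [map_add, map_smul, add_apply, smul_apply, hNv, smul_zero, zero_add] at horth
    exact horth
  have hV := hG.pos x hx v' hv0
  have hW := hG.nonneg hx w
  have hgram : G x (s • N + w) (s • N + w) = s ^ 2 + G x w w := by
    simp only [map_add, map_smul, add_apply, smul_apply, smul_eq_mul, hGNN, hNw, hwN]
    ring
  -- Since dφ(v') = 0 and the basis is G-orthogonal, it is also Gh-orthogonal; only the N-component
  -- of the first vector is rescaled.
  have hden : Gh x (s • N + w) (s • N + w) * Gh x v' v' - Gh x (s • N + w) v' ^ 2 =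
      (s ^ 2 / l ^ 2 + G x w w) * G x v' v' := by
    rw [hs x hx, hs x hx, hs x hx, hgram, hv, horth, ← hs']
    field_simp
    ring
  have hHu (z : E) : coordHessian G φ x (s • N + w) z = coordHessian G φ x w z := by
    rw [coordHessian_symm hφ hG hx, coordHessian_add_right hG hx, coordHessian_smul_right hG hx,
      coordHessian_grad hφ hG hx, mul_zero, zero_add, coordHessian_symm hφ hG hx]
  have hnum : Gh x (riemannTensor Gh x (s • N + w) v' v') (s • N + w) =
      G x (riemannTensor G x (s • N + w) v' v') (s • N + w) - (l ^ 2 - 1) *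
        (coordHessian G φ x w w * coordHessian G φ x v' v' - coordHessian G φ x w v' ^ 2) := by
    rw [apply_riemannTensor_stretch hφ hG hGh hs hl0 hx, hHu, hHu,
      coordHessian_symm hφ hG hx w (s • N + w), hHu, coordHessian_symm hφ hG hx v' (s • N + w), hHu]
    ring
  have hpos : 0 < (s ^ 2 / l ^ 2 + G x w w) * G x v' v' := by
    apply mul_pos _ hV
    rcases eq_or_ne w 0 with rfl | hw0
    · have : s ≠ 0 := by rintro rfl; simp at hu0
      have : 0 < s ^ 2 / l ^ 2 := by positivity
      linarith
    · have := hG.pos x hx w hw0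
      positivity
  have hHb := coordHessian_gram_bounds hφ hG hx hc₁ hc hH hw hv hwv
  have hl2 : 0 ≤ l ^ 2 - 1 := by nlinarith
  have hsl : s ^ 2 / l ^ 2 * l ^ 2 = s ^ 2 := by field_simp
  have hsl0 : 0 ≤ s ^ 2 / l ^ 2 := by positivity
  rw [coordSectionalCurvature, hden, hnum, le_div_iff₀ hpos, div_le_iff₀ hpos]
  constructor
  · have h1 := (abs_le.1 (abs_apply_riemannTensor_le hG hx hK hv0 horth)).1
    rw [hgram] at h1
    have h2 := mul_le_mul_of_nonneg_left hHb.2 hl2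
    -- The factor l² in the lower bound compensates for the shrinking of the N-direction, s² = l² ·
    -- (s²/l²).
    have h3 : Λ * (s ^ 2 + G x w w) + (l ^ 2 - 1) * c₂ ^ 2 * G x w w ≤
        (Λ * l ^ 2 + (l ^ 2 - 1) * c₂ ^ 2) * (s ^ 2 / l ^ 2 + G x w w) := by
      have e : (Λ * l ^ 2 + (l ^ 2 - 1) * c₂ ^ 2) * (s ^ 2 / l ^ 2 + G x w w) =
          Λ * (s ^ 2 / l ^ 2 * l ^ 2 + G x w w) + (l ^ 2 - 1) * c₂ ^ 2 * G x w w
            + (Λ * ((l ^ 2 - 1) * G x w w) + (l ^ 2 - 1) * c₂ ^ 2 * (s ^ 2 / l ^ 2)) := by ring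
      rw [e, hsl]
      have : 0 ≤ Λ * ((l ^ 2 - 1) * G x w w) + (l ^ 2 - 1) * c₂ ^ 2 * (s ^ 2 / l ^ 2) := by
        positivity
      linarith
    have h4 := mul_le_mul_of_nonneg_right h3 hV.le
    linarith
  -- The value t = 2Λ/δ + 1 makes Λ/t ≤ δ/2, so the mixed term uses up at most half of -δs². The
  -- summand 1 keeps t positive when Λ = 0.
  · have h1 := apply_riemannTensor_le hφ hG hx hK hKg s (t := 2 * Λ / δ + 1) (by positivity)
      hv0 hv hw hwv
    have h2 := mul_le_mul_of_nonneg_left hHb.1 hl2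
    have ht : Λ / (2 * Λ / δ + 1) ≤ δ / 2 := by
      rw [div_le_iff₀ (by positivity)]
      have : δ / 2 * (2 * Λ / δ + 1) = Λ + δ / 2 := by field_simp
      linarith
    have h3 : -δ * s ^ 2 + Λ / (2 * Λ / δ + 1) * s ^ 2
        + (Λ * (2 * Λ / δ + 1) + Λ) * G x w w - (l ^ 2 - 1) * c₁ ^ 2 * G x w w ≤
        -min (δ / 2) 1 * (s ^ 2 / l ^ 2 + G x w w) := by
      have e1 := mul_le_mul_of_nonneg_right ht (sq_nonneg s)
      have e2 := mul_le_mul_of_nonneg_right hl hW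
      have e3 : s ^ 2 / l ^ 2 ≤ s ^ 2 := div_le_self (sq_nonneg s) (by linarith)
      have e4 : min (δ / 2) 1 * (s ^ 2 / l ^ 2) ≤ δ / 2 * s ^ 2 :=
        mul_le_mul (min_le_left _ _) e3 hsl0 (by positivity)
      have e5 : min (δ / 2) 1 * G x w w ≤ 1 * G x w w :=
        mul_le_mul_of_nonneg_right (min_le_right _ _) hW
      linarith
    have h4 := mul_le_mul_of_nonneg_right h3 hV.le
    linarith

end Pinching

/-! ### Geodesics in coordinates -/

section CoordinateGeodesics

variable {E : Type*} [NormedAddCommGroup E] [NormedSpace ℝ E] [FiniteDimensional ℝ E]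
  {G : E → E →L[ℝ] E →L[ℝ] ℝ} {U : Set E} {x : E} {φ : E → ℝ}

/-- `γ` with velocity `y` solves the geodesic equation of `G` in `U` on `(-ε, ε)`. -/
structure IsCoordGeodesic (G : E → E →L[ℝ] E →L[ℝ] ℝ) (U : Set E) (ε : ℝ) (γ y : ℝ → E) :
    Prop where
  mem : ∀ t ∈ Set.Ioo (-ε) ε, γ t ∈ U
  hasDerivAt : ∀ t ∈ Set.Ioo (-ε) ε, HasDerivAt γ (y t) t
  hasDerivAt_velocity : ∀ t ∈ Set.Ioo (-ε) ε,
    HasDerivAt y (-christoffel G (γ t) (y t) (y t)) t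

theorem IsCoordMetricOn.exists_coordGeodesic (hG : IsCoordMetricOn G U) (hx : x ∈ U) (u : E) :
    ∃ ε > 0, ∃ γ y : ℝ → E, γ 0 = x ∧ y 0 = u ∧ IsCoordGeodesic G U ε γ y := by
  have := FiniteDimensional.complete ℝ E
  -- The geodesic equation is the autonomous first-order system (γ, y)' = (y, -Γ_γ(y, y)) on E × E,
  -- to which Picard-Lindelöf applies.
  have hF : ContDiffAt ℝ 1 (fun p : E × E => (p.2, -christoffel G p.1 p.2 p.2)) (x, u) :=
    (contDiffAt_snd.prodMk (hG.contDiffAt_christoffel hx).neg).of_le (by simp)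
  obtain ⟨α, hα0, ε, hε, hα⟩ :=
    hF.exists_forall_mem_closedBall_exists_eq_forall_mem_Ioo_hasDerivAt₀ 0
  have hcont : ContinuousAt (fun t => (α t).1) 0 :=
    continuous_fst.continuousAt.comp (hα 0 (by simp [hε])).continuousAt
  have hU : ∀ᶠ t in 𝓝 (0 : ℝ), (α t).1 ∈ U :=
    hcont.eventually (show U ∈ 𝓝 (α 0).1 by rw [hα0]; exact hG.isOpen.mem_nhds hx)
  obtain ⟨r, hr, hrU⟩ := Metric.eventually_nhds_iff.1 hU
  have hsub : ∀ t ∈ Set.Ioo (-min ε r) (min ε r), t ∈ Set.Ioo (0 - ε) (0 + ε) := by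
    intro t ht
    have := min_le_left ε r
    constructor <;> linarith [ht.1, ht.2]
  refine ⟨min ε r, lt_min hε hr, fun t => (α t).1, fun t => (α t).2, by simp [hα0],
    by simp [hα0], ⟨fun t ht => ?_, fun t ht => ?_, fun t ht => ?_⟩⟩
  · apply hrU
    rw [Real.dist_eq, sub_zero, abs_lt]
    have := min_le_right ε r
    constructor <;> linarith [ht.1, ht.2]
  · exact (hα t (hsub t ht)).fst
  · exact (hα t (hsub t ht)).snd

namespace IsCoordGeodesic

variable {ε : ℝ} {γ y : ℝ → E}

theorem deriv_eventuallyEq (h : IsCoordGeodesic G U ε γ y) {t : ℝ} (ht : t ∈ Set.Ioo (-ε) ε) :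
    deriv γ =ᶠ[𝓝 t] y := by
  filter_upwards [isOpen_Ioo.mem_nhds ht] with s hs using (h.hasDerivAt s hs).deriv

theorem deriv_deriv (h : IsCoordGeodesic G U ε γ y) {t : ℝ} (ht : t ∈ Set.Ioo (-ε) ε) :
    deriv (deriv γ) t = -christoffel G (γ t) (y t) (y t) := by
  rw [(h.deriv_eventuallyEq ht).deriv_eq, (h.hasDerivAt_velocity t ht).deriv]

/-- Bootstrapping: the right-hand side of the equation is continuous, so y is C¹ and γ is C², as
`IsGeodesicOn` demands. -/
theorem contDiffOn (h : IsCoordGeodesic G U ε γ y) (hG : IsCoordMetricOn G U) :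
    ContDiffOn ℝ 2 γ (Set.Ioo (-ε) ε) := by
  have hγc : ContinuousOn γ (Set.Ioo (-ε) ε) := fun t ht =>
    (h.hasDerivAt t ht).continuousAt.continuousWithinAt
  have hyc : ContinuousOn y (Set.Ioo (-ε) ε) := fun t ht =>
    (h.hasDerivAt_velocity t ht).continuousAt.continuousWithinAt
  have hac : ContinuousOn (fun t => -christoffel G (γ t) (y t) (y t)) (Set.Ioo (-ε) ε) := by
    intro t ht
    have h1 := (hG.contDiffAt_christoffel (y := y t) (h.mem t ht)).continuousAt
    exact ((ContinuousAt.comp_continuousWithinAt (f := fun t => (γ t, y t)) (x := t) h1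
      ((hγc t ht).prodMk (hyc t ht)))).neg
  have hy1 : ContDiffOn ℝ 1 y (Set.Ioo (-ε) ε) := by
    rw [show (1 : WithTop ℕ∞) = 0 + 1 from rfl, contDiffOn_succ_iff_deriv_of_isOpen isOpen_Ioo]
    refine ⟨fun t ht => (h.hasDerivAt_velocity t ht).differentiableAt.differentiableWithinAt,
      by simp, ?_⟩
    rw [contDiffOn_zero]
    exact hac.congr fun t ht => (h.hasDerivAt_velocity t ht).deriv
  rw [show (2 : WithTop ℕ∞) = 1 + 1 from rfl, contDiffOn_succ_iff_deriv_of_isOpen isOpen_Ioo]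
  exact ⟨fun t ht => (h.hasDerivAt t ht).differentiableAt.differentiableWithinAt, by simp,
    hy1.congr fun t ht => (h.hasDerivAt t ht).deriv⟩

/-- A geodesic has constant speed. -/
theorem speed_eq (h : IsCoordGeodesic G U ε γ y) (hG : IsCoordMetricOn G U) {t : ℝ}
    (ht : t ∈ Set.Ioo (-ε) ε) : G (γ t) (y t) (y t) = G (γ 0) (y 0) (y 0) := by
  have hε : 0 < ε := by linarith [ht.1, ht.2]
  have hd : ∀ s ∈ Set.Ioo (-ε) ε, HasDerivAt (fun s => G (γ s) (y s) (y s)) 0 s := by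
    intro s hs
    have hx := h.mem s hs
    have h1 : HasDerivAt (fun s => G (γ s)) (fderiv ℝ G (γ s) (y s)) s :=
      (hG.differentiableAt hx).hasFDerivAt.comp_hasDerivAt s (h.hasDerivAt s hs)
    have h2 := (h1.clm_apply (h.hasDerivAt_velocity s hs)).clm_apply (h.hasDerivAt_velocity s hs)
    refine h2.congr_deriv ?_
    simp only [map_neg, add_apply, neg_apply, hG.fderiv_eq_christoffel hx]
    ring
  exact isOpen_Ioo.is_const_of_deriv_eq_zero (convex_Ioo _ _).isPreconnected
    (fun s hs => (hd s hs).differentiableAt.differentiableWithinAt) (fun s hs => (hd s hs).deriv)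
    ht ⟨by linarith, hε⟩

/-- The second derivative of `φ` along a geodesic is the Hessian. -/
theorem deriv_deriv_comp (h : IsCoordGeodesic G U ε γ y) (hG : IsCoordMetricOn G U)
    (hφ : ContDiffOn ℝ ∞ φ U) {t : ℝ} (ht : t ∈ Set.Ioo (-ε) ε) :
    deriv (deriv (φ ∘ γ)) t = coordHessian G φ (γ t) (y t) (y t) := by
  have hφ' : ∀ x ∈ U, ContDiffAt ℝ ∞ φ x := fun x hx => hφ.contDiffAt (hG.isOpen.mem_nhds hx)
  have h1 : deriv (φ ∘ γ) =ᶠ[𝓝 t] fun s => fderiv ℝ φ (γ s) (y s) := by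
    filter_upwards [isOpen_Ioo.mem_nhds ht] with s hs
    exact (((hφ' _ (h.mem s hs)).differentiableAt (by simp)).hasFDerivAt.comp_hasDerivAt s
      (h.hasDerivAt s hs)).deriv
  have h2 : HasDerivAt (fun s => fderiv ℝ φ (γ s)) (fderiv ℝ (fderiv ℝ φ) (γ t) (y t)) t :=
    ((contDiffAt_fderiv_of_infty (hφ' _ (h.mem t ht))).differentiableAt
      (by simp)).hasFDerivAt.comp_hasDerivAt t (h.hasDerivAt t ht)
  rw [h1.deriv_eq, (h2.clm_apply (h.hasDerivAt_velocity t ht)).deriv, coordHessian, map_neg,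
    sub_eq_add_neg]

end IsCoordGeodesic

end CoordinateGeodesics

/-! ### Smooth sections tested on chart frames -/

section ManifoldSections

variable {E : Type*} [NormedAddCommGroup E] [NormedSpace ℝ E]
  {Y : Type*} [TopologicalSpace Y] [ChartedSpace E Y]

theorem contMDiffAt_of_forall_apply {F : Type*}
    [NormedAddCommGroup F] [NormedSpace ℝ F] [FiniteDimensional ℝ E] {n : WithTop ℕ∞}
    {f : Y → E →L[ℝ] F} {p : Y}
    (h : ∀ w, ContMDiffAt 𝓘(ℝ, E) 𝓘(ℝ, F) n (fun y => f y w) p) :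
    ContMDiffAt 𝓘(ℝ, E) 𝓘(ℝ, E →L[ℝ] F) n f p := by
  let d := Module.finrank ℝ E
  have hd : d = Module.finrank ℝ (Fin d → ℝ) := (Module.finrank_fin_fun ℝ).symm
  let e₁ := ContinuousLinearEquiv.ofFinrankEq hd
  let e₂ := (e₁.arrowCongr (1 : F ≃L[ℝ] F)).trans (ContinuousLinearEquiv.piRing (Fin d))
  rw [← Function.id_comp f, ← e₂.symm_comp_self]
  exact e₂.symm.contDiff.contMDiff.contMDiffAt.comp p (contMDiffAt_pi_space.mpr fun i => h _)

variable [IsManifold 𝓘(ℝ, E) ∞ Y]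

theorem contMDiffAt_trivialization_symm (q : Y) (u : E) {p : Y} (hp : p ∈ (chartAt E q).source) :
    ContMDiffAt 𝓘(ℝ, E) 𝓘(ℝ, E).tangent ∞
      (fun y => (⟨y, (trivializationAt E (TangentSpace 𝓘(ℝ, E)) q).symm y u⟩ :
        TangentBundle 𝓘(ℝ, E) Y)) p := by
  set e := trivializationAt E (TangentSpace 𝓘(ℝ, E) : Y → Type _) q
  have hbase : e.baseSet = (chartAt E q).source := TangentBundle.trivializationAt_baseSet q
  have h1 : ContMDiffAt (𝓘(ℝ, E).prod 𝓘(ℝ, E)) (𝓘(ℝ, E).prod 𝓘(ℝ, E)) ∞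
      e.toOpenPartialHomeomorph.symm (p, u) := by
    have := e.contMDiffOn_symm (IB := 𝓘(ℝ, E)) (n := ∞)
    refine this.contMDiffAt (e.open_target.mem_nhds ?_)
    rw [e.mem_target, hbase]; exact hp
  have h2 : ContMDiffAt 𝓘(ℝ, E) (𝓘(ℝ, E).prod 𝓘(ℝ, E)) ∞ (fun y : Y => (y, u)) p :=
    contMDiffAt_id.prodMk contMDiffAt_const
  have h3 := h1.comp p h2
  refine h3.congr_of_eventuallyEq ?_
  filter_upwards [(chartAt E q).open_source.mem_nhds hp] with y hy
  exact e.mk_symm (by rw [hbase]; exact hy) u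

theorem SmoothMetric.contMDiffAt_apply (g : SmoothMetric E Y) {p : Y}
    {s t : ∀ y : Y, TangentSpace 𝓘(ℝ, E) y}
    (hs : ContMDiffAt 𝓘(ℝ, E) 𝓘(ℝ, E).tangent ∞
      (fun y => (⟨y, s y⟩ : TangentBundle 𝓘(ℝ, E) Y)) p)
    (ht : ContMDiffAt 𝓘(ℝ, E) 𝓘(ℝ, E).tangent ∞
      (fun y => (⟨y, t y⟩ : TangentBundle 𝓘(ℝ, E) Y)) p) :
    ContMDiffAt 𝓘(ℝ, E) 𝓘(ℝ, ℝ) ∞ (fun y => g.inner y (s y) (t y)) p := by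
  have : ContMDiffAt 𝓘(ℝ, E) (𝓘(ℝ, E).prod 𝓘(ℝ)) ∞
      (fun m ↦ Bundle.TotalSpace.mk' ℝ (E := Bundle.Trivial Y ℝ) m (g.inner m (s m) (t m))) p := by
    apply ContMDiffAt.clm_bundle_apply₂ (F₁ := E) (F₂ := E)
    · exact g.contMDiff.contMDiffAt
    · exact hs
    · exact ht
  simp only [Bundle.contMDiffAt_totalSpace] at this
  exact this.2

theorem contMDiffAt_mfderiv_apply {f : Y → ℝ} (hf : ContMDiff 𝓘(ℝ, E) 𝓘(ℝ, ℝ) ∞ f) {p : Y}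
    {s : ∀ y : Y, TangentSpace 𝓘(ℝ, E) y}
    (hs : ContMDiffAt 𝓘(ℝ, E) 𝓘(ℝ, E).tangent ∞
      (fun y => (⟨y, s y⟩ : TangentBundle 𝓘(ℝ, E) Y)) p) :
    ContMDiffAt 𝓘(ℝ, E) 𝓘(ℝ, ℝ) ∞ (fun y => (mfderiv 𝓘(ℝ, E) 𝓘(ℝ, ℝ) f y (s y) : ℝ)) p := by
  have h1 : ContMDiff 𝓘(ℝ, E).tangent 𝓘(ℝ, ℝ).tangent ∞ (tangentMap 𝓘(ℝ, E) 𝓘(ℝ, ℝ) f) :=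
    hf.contMDiff_tangentMap (by simp)
  have h2 := h1.contMDiffAt.comp p hs
  have h3 : ContMDiff 𝓘(ℝ, ℝ).tangent 𝓘(ℝ, ℝ) ∞ (fun v : TangentBundle 𝓘(ℝ, ℝ) ℝ => v.2) :=
    contMDiff_snd_tangentBundle_modelSpace ℝ 𝓘(ℝ, ℝ)
  exact h3.contMDiffAt.comp p h2

/-- A field of bilinear forms is smooth when its values on the chart frames are. -/
theorem contMDiffAt_bilin_section [FiniteDimensional ℝ E]
    (B : ∀ y : Y, TangentSpace 𝓘(ℝ, E) y →L[ℝ] TangentSpace 𝓘(ℝ, E) y →L[ℝ] ℝ) (p : Y)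
    (hB : ∀ u v : E, ContMDiffAt 𝓘(ℝ, E) 𝓘(ℝ, ℝ) ∞
      (fun y => B y ((trivializationAt E (TangentSpace 𝓘(ℝ, E)) p).symm y u)
        ((trivializationAt E (TangentSpace 𝓘(ℝ, E)) p).symm y v)) p) :
    ContMDiffAt 𝓘(ℝ, E) (𝓘(ℝ, E).prod 𝓘(ℝ, E →L[ℝ] E →L[ℝ] ℝ)) ∞
      (fun y => Bundle.TotalSpace.mk' (E →L[ℝ] E →L[ℝ] ℝ)
        (E := fun y : Y => TangentSpace 𝓘(ℝ, E) y →L[ℝ] TangentSpace 𝓘(ℝ, E) y →L[ℝ] ℝ)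
        y (B y)) p := by
  refine (contMDiffAt_hom_bundle _).2 ⟨contMDiffAt_id, ?_⟩
  refine contMDiffAt_of_forall_apply fun u => contMDiffAt_of_forall_apply fun v => ?_
  refine (hB u v).congr_of_eventuallyEq ?_
  filter_upwards [(chartAt E p).open_source.mem_nhds (mem_chart_source E p)] with y hy
  refine (inCoordinates_apply_eq₂ (E₃ := Bundle.Trivial Y ℝ) hy hy (by simp)).trans ?_
  simp

end ManifoldSections

/-! ### Transfer between the manifold and its charts -/

section MetricsInCharts

variable {E : Type*} [NormedAddCommGroup E] [NormedSpace ℝ E]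
  {Y : Type*} [TopologicalSpace Y] [ChartedSpace E Y] [IsManifold 𝓘(ℝ, E) ∞ Y]

/-- The inner product of `g` at `p`, on the model space. -/
def innerAt (g : SmoothMetric E Y) (p : Y) : E →L[ℝ] E →L[ℝ] ℝ := g.inner p

/-- The differential of `f` at `p`, on the model space. -/
def differentialAt (f : Y → ℝ) (p : Y) : E →L[ℝ] ℝ := mfderiv 𝓘(ℝ, E) 𝓘(ℝ, ℝ) f p

/-- The gradient of `f` at `p`, on the model space. -/
def gradAt (g : SmoothMetric E Y) (f : Y → ℝ) (p : Y) : E := riemGrad g f p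

/-- The derivative at `x` of the inverse of the chart around `q`. -/
def chartInvDeriv (q : Y) (x : E) : E →L[ℝ] E :=
  mfderiv 𝓘(ℝ, E) 𝓘(ℝ, E) (extChartAt 𝓘(ℝ, E) q).symm x

theorem coordMetric_apply (g : SmoothMetric E Y) (q : Y) (x u v : E) :
    coordMetric g q x u v = innerAt g ((extChartAt 𝓘(ℝ, E) q).symm x) (chartInvDeriv q x u)
      (chartInvDeriv q x v) := rfl

theorem chartInvDeriv_eq_mfderivWithin (q : Y) (x : E) :
    chartInvDeriv q x =
      mfderivWithin 𝓘(ℝ, E) 𝓘(ℝ, E) (extChartAt 𝓘(ℝ, E) q).symm (Set.range 𝓘(ℝ, E)) x := by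
  rw [modelWithCornersSelf_coe, Set.range_id, mfderivWithin_univ]
  rfl

theorem chartInvDeriv_isInvertible {q : Y} {x : E} (hx : x ∈ (extChartAt 𝓘(ℝ, E) q).target) :
    (chartInvDeriv q x).IsInvertible := by
  rw [chartInvDeriv_eq_mfderivWithin]
  have : IsManifold 𝓘(ℝ, E) 1 Y := .of_le (n := ∞) (by simp)
  exact isInvertible_mfderivWithin_extChartAt_symm hx

theorem extChartAt_symm_mem_source {q : Y} {x : E} (hx : x ∈ (extChartAt 𝓘(ℝ, E) q).target) :
    (extChartAt 𝓘(ℝ, E) q).symm x ∈ (chartAt E q).source := by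
  rw [← extChartAt_source 𝓘(ℝ, E)]
  exact (extChartAt 𝓘(ℝ, E) q).map_target hx

/-- Coordinate frames are the frames of the tangent bundle trivialization, so smoothness of g as a
bundle section becomes smoothness of `coordMetric`. -/
theorem chartInvDeriv_apply {q : Y} {x : E} (hx : x ∈ (extChartAt 𝓘(ℝ, E) q).target) (u : E) :
    chartInvDeriv q x u = (trivializationAt E (TangentSpace 𝓘(ℝ, E)) q).symm
      ((extChartAt 𝓘(ℝ, E) q).symm x) u := by
  have : IsManifold 𝓘(ℝ, E) 1 Y := .of_le (n := ∞) (by simp)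
  have h := TangentBundle.symmL_trivializationAt (I := 𝓘(ℝ, E)) (extChartAt_symm_mem_source hx)
  rw [(extChartAt 𝓘(ℝ, E) q).right_inv hx] at h
  rw [chartInvDeriv_eq_mfderivWithin, ← Bundle.Trivialization.symmL_apply (R := ℝ)
    (hb := extChartAt_symm_mem_source hx)]
  exact (congrArg (fun A : E →L[ℝ] E => A u) h).symm

theorem contMDiffAt_extChartAt_symm {q : Y} {x : E} (hx : x ∈ (extChartAt 𝓘(ℝ, E) q).target) :
    ContMDiffAt 𝓘(ℝ, E) 𝓘(ℝ, E) ∞ (extChartAt 𝓘(ℝ, E) q).symm x :=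
  (contMDiffOn_extChartAt_symm q).contMDiffAt ((isOpen_extChartAt_target q).mem_nhds hx)

variable [FiniteDimensional ℝ E]

omit [FiniteDimensional ℝ E] in
theorem innerAt_pos (g : SmoothMetric E Y) (p : Y) (u : E) (hu : u ≠ 0) : 0 < innerAt g p u u :=
  g.pos p u hu

omit [FiniteDimensional ℝ E] in
theorem innerAt_symm (g : SmoothMetric E Y) (p : Y) (u v : E) :
    innerAt g p u v = innerAt g p v u :=
  g.symm p u v

theorem contDiffAt_coordMetric (g : SmoothMetric E Y) {q : Y} {x : E}
    (hx : x ∈ (extChartAt 𝓘(ℝ, E) q).target) : ContDiffAt ℝ ∞ (coordMetric g q) x := by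
  refine contDiffAt_of_forall_apply fun u => contDiffAt_of_forall_apply fun v => ?_
  have hs := extChartAt_symm_mem_source hx
  have h := ContMDiffAt.comp x (g.contMDiffAt_apply (contMDiffAt_trivialization_symm q u hs)
    (contMDiffAt_trivialization_symm q v hs)) (contMDiffAt_extChartAt_symm hx)
  refine h.contDiffAt.congr_of_eventuallyEq ?_
  filter_upwards [(isOpen_extChartAt_target (I := 𝓘(ℝ, E)) q).mem_nhds hx] with y hy
  rw [coordMetric_apply, chartInvDeriv_apply hy, chartInvDeriv_apply hy]
  rfl

theorem isCoordMetricOn_coordMetric (g : SmoothMetric E Y) (q : Y) :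
    IsCoordMetricOn (coordMetric g q) (extChartAt 𝓘(ℝ, E) q).target where
  isOpen := isOpen_extChartAt_target q
  contDiffOn x hx := (contDiffAt_coordMetric g hx).contDiffWithinAt
  symm x _ u v := by rw [coordMetric_apply, coordMetric_apply, innerAt_symm]
  pos x hx u hu := by
    rw [coordMetric_apply]
    refine innerAt_pos g _ _ fun h => hu ?_
    exact (chartInvDeriv_isInvertible hx).injective (h.trans (map_zero (chartInvDeriv q x)).symm)

theorem innerAt_gradAt (g : SmoothMetric E Y) (f : Y → ℝ) (p : Y) (v : E) :
    innerAt g p (gradAt g f p) v = differentialAt f p v :=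
  congrArg (fun A : E →L[ℝ] ℝ => A v)
    ((isInvertible_of_posDef (innerAt g p) (innerAt_pos g p)).self_apply_inverse
      (differentialAt f p))

variable {f : Y → ℝ}

theorem fderiv_comp_extChartAt_symm (hf : ContMDiff 𝓘(ℝ, E) 𝓘(ℝ, ℝ) ∞ f) {q : Y} {x : E}
    (hx : x ∈ (extChartAt 𝓘(ℝ, E) q).target) (u : E) :
    fderiv ℝ (f ∘ (extChartAt 𝓘(ℝ, E) q).symm) x u =
      differentialAt f ((extChartAt 𝓘(ℝ, E) q).symm x) (chartInvDeriv q x u) := by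
  rw [← mfderiv_eq_fderiv, mfderiv_comp x (hf.mdifferentiableAt (by simp))
    ((contMDiffAt_extChartAt_symm hx).mdifferentiableAt (by simp))]
  rfl

theorem isUnitGradientOn_comp_extChartAt_symm (g : SmoothMetric E Y)
    (hf : ContMDiff 𝓘(ℝ, E) 𝓘(ℝ, ℝ) ∞ f)
    (hgrad : ∀ p : Y, innerAt g p (gradAt g f p) (gradAt g f p) = 1) (q : Y) :
    IsUnitGradientOn (coordMetric g q) (f ∘ (extChartAt 𝓘(ℝ, E) q).symm)
      (extChartAt 𝓘(ℝ, E) q).target where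
  contDiffOn x hx :=
    (hf.contMDiffAt.comp x (contMDiffAt_extChartAt_symm hx)).contDiffAt.contDiffWithinAt
  apply_grad x hx := by
    obtain ⟨w, hw⟩ := (chartInvDeriv_isInvertible hx).surjective
      (gradAt g f ((extChartAt 𝓘(ℝ, E) q).symm x))
    have h : coordGrad (coordMetric g q) (f ∘ (extChartAt 𝓘(ℝ, E) q).symm) x = w := by
      refine (isCoordMetricOn_coordMetric g q).inverse_eq hx fun z => ?_
      rw [coordMetric_apply, hw, fderiv_comp_extChartAt_symm hf hx]
      exact innerAt_gradAt g f _ _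
    rw [h, fderiv_comp_extChartAt_symm hf hx, hw, ← hgrad ((extChartAt 𝓘(ℝ, E) q).symm x)]
    exact (innerAt_gradAt g f _ _).symm

/-- The preferred chart at p has derivative the identity at p itself, when `TangentSpace` is read as
E. This lets pointwise hypotheses on the manifold serve as coordinate hypotheses. -/
theorem coordMetric_self (g : SmoothMetric E Y) (p : Y) :
    coordMetric g p (extChartAt 𝓘(ℝ, E) p p) = innerAt g p := by
  have : IsManifold 𝓘(ℝ, E) 1 Y := .of_le (n := ∞) (by simp)
  have h1 : chartInvDeriv p (extChartAt 𝓘(ℝ, E) p p) = ContinuousLinearMap.id ℝ E := by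
    rw [chartInvDeriv_eq_mfderivWithin]
    exact mfderivWithin_range_extChartAt_symm
  have h2 := congrArg (innerAt g)
    (extChartAt_to_inv (I := 𝓘(ℝ, E)) p)
  ext u v
  rw [coordMetric_apply, h1]
  exact congrArg (fun A : E →L[ℝ] E →L[ℝ] ℝ => A u v) h2

theorem fderiv_comp_extChartAt_symm_self (hf : ContMDiff 𝓘(ℝ, E) 𝓘(ℝ, ℝ) ∞ f) (p : Y) :
    fderiv ℝ (f ∘ (extChartAt 𝓘(ℝ, E) p).symm) (extChartAt 𝓘(ℝ, E) p p) =
      differentialAt f p := by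
  have : IsManifold 𝓘(ℝ, E) 1 Y := .of_le (n := ∞) (by simp)
  have h1 : chartInvDeriv p (extChartAt 𝓘(ℝ, E) p p) = ContinuousLinearMap.id ℝ E := by
    rw [chartInvDeriv_eq_mfderivWithin]
    exact mfderivWithin_range_extChartAt_symm
  have h2 := congrArg (differentialAt (E := E) f)
    (extChartAt_to_inv (I := 𝓘(ℝ, E)) p)
  ext u
  rw [fderiv_comp_extChartAt_symm hf (mem_extChartAt_target p), h1]
  exact congrArg (fun A : E →L[ℝ] ℝ => A u) h2

theorem coordGrad_self (g : SmoothMetric E Y) (hf : ContMDiff 𝓘(ℝ, E) 𝓘(ℝ, ℝ) ∞ f) (p : Y) :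
    coordGrad (coordMetric g p) (f ∘ (extChartAt 𝓘(ℝ, E) p).symm) (extChartAt 𝓘(ℝ, E) p p) =
      gradAt g f p := by
  rw [coordGrad, coordMetric_self, fderiv_comp_extChartAt_symm_self hf]
  rfl

theorem mfderiv_extChartAt_self_apply (p : Y) (u : TangentSpace 𝓘(ℝ, E) p) :
    mfderiv 𝓘(ℝ, E) 𝓘(ℝ, E) (extChartAt 𝓘(ℝ, E) p) p u = u := by
  have : IsManifold 𝓘(ℝ, E) 1 Y := .of_le (n := ∞) (by simp)
  rw [mfderiv_extChartAt_self]
  rfl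

theorem sectionalCurvature_eq (g : SmoothMetric E Y) (p : Y) (u v : E) :
    sectionalCurvature g p u v =
      coordSectionalCurvature (coordMetric g p) (extChartAt 𝓘(ℝ, E) p p) u v :=
  congrArg₂ (coordSectionalCurvature (coordMetric g p) (extChartAt 𝓘(ℝ, E) p p))
    (mfderiv_extChartAt_self_apply p u) (mfderiv_extChartAt_self_apply p v)

end MetricsInCharts

/-! ### Construction of the stretched metric -/

section StretchedMetric

variable {E : Type*} [NormedAddCommGroup E] [NormedSpace ℝ E] [FiniteDimensional ℝ E]
  {Y : Type*} [TopologicalSpace Y] [ChartedSpace E Y] [IsManifold 𝓘(ℝ, E) ∞ Y]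
  {f : Y → ℝ}

/-- Cauchy-Schwarz for the differential of a function with unit gradient. -/
theorem mfderiv_apply_sq_le (g : SmoothMetric E Y)
    (hgrad : ∀ p : Y, innerAt g p (gradAt g f p) (gradAt g f p) = 1) (p : Y)
    (v : E) :
    differentialAt f p v ^ 2 ≤ innerAt g p v v := by
  set α : ℝ := differentialAt f p v with hα
  have h1 : innerAt g p (gradAt g f p) v = α := innerAt_gradAt g f p v
  have h2 : innerAt g p v (gradAt g f p) = α := by rw [innerAt_symm, h1]
  have h3 : 0 ≤ innerAt g p (v - α • gradAt g f p) (v - α • gradAt g f p) := by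
    rcases eq_or_ne (v - α • gradAt g f p) 0 with h | h
    · rw [h]; simp
    · exact (innerAt_pos g p _ h).le
  simp only [map_sub, map_smul, sub_apply, smul_apply, smul_eq_mul, h1, h2] at h3
  have h4 : innerAt g p (gradAt g f p) (gradAt g f p) = 1 := hgrad p
  rw [h4] at h3
  nlinarith

/-- The bilinear form `g - (1 - l⁻²) df ⊗ df`. -/
def stretchedInner (g : SmoothMetric E Y) (f : Y → ℝ) (l : ℝ) (p : Y) :
    E →L[ℝ] E →L[ℝ] ℝ :=
  innerAt g p - (1 - (l ^ 2)⁻¹) • (differentialAt f p).smulRight (differentialAt f p)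

theorem stretchedInner_apply (g : SmoothMetric E Y) (f : Y → ℝ) (l : ℝ) (p : Y)
    (u v : E) :
    stretchedInner g f l p u v = innerAt g p u v - (1 - (l ^ 2)⁻¹) *
      (differentialAt f p u * differentialAt f p v) := rfl

/-- The difference l²h(v, v) - g(v, v) equals (l² - 1)(g(v, v) - df(v)²), nonnegative by
Cauchy-Schwarz. -/
theorem inner_le_mul_stretchedInner (g : SmoothMetric E Y)
    (hgrad : ∀ p : Y, innerAt g p (gradAt g f p) (gradAt g f p) = 1) {l : ℝ} (hl : 1 ≤ l)
    (p : Y) (v : E) :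
    innerAt g p v v ≤ l ^ 2 * stretchedInner g f l p v v := by
  have h := mfderiv_apply_sq_le g hgrad p v
  rw [stretchedInner_apply]
  have hl2 : 0 ≤ l ^ 2 - 1 := by nlinarith
  have h2 := mul_le_mul_of_nonneg_left h hl2
  have e : l ^ 2 * (innerAt g p v v - (1 - (l ^ 2)⁻¹) *
      (differentialAt f p v * differentialAt f p v)) =
      l ^ 2 * innerAt g p v v - (l ^ 2 - 1) * differentialAt f p v ^ 2 := by
    have : l ≠ 0 := by positivity
    field_simp
  rw [e]
  linarith

theorem stretchedInner_le_inner (g : SmoothMetric E Y) {l : ℝ} (hl : 1 ≤ l)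
    (p : Y) (v : E) :
    stretchedInner g f l p v v ≤ innerAt g p v v := by
  rw [stretchedInner_apply]
  have : (l ^ 2)⁻¹ ≤ 1 := inv_le_one_of_one_le₀ (by nlinarith)
  have := mul_nonneg (sub_nonneg.2 this)
    (mul_self_nonneg (differentialAt f p v))
  linarith

theorem stretchedInner_symm (g : SmoothMetric E Y) (f : Y → ℝ) (l : ℝ) (p : Y) (u v : E) :
    stretchedInner g f l p u v = stretchedInner g f l p v u := by
  rw [stretchedInner_apply, stretchedInner_apply, innerAt_symm]; ring

theorem stretchedInner_pos (g : SmoothMetric E Y)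
    (hgrad : ∀ p : Y, innerAt g p (gradAt g f p) (gradAt g f p) = 1) {l : ℝ} (hl : 1 ≤ l)
    (p : Y) (v : E) (hv : v ≠ 0) : 0 < stretchedInner g f l p v v :=
  pos_of_mul_pos_right
    ((innerAt_pos g p v hv).trans_le (inner_le_mul_stretchedInner g hgrad hl p v)) (by positivity)

/-- From g ≤ l²h, the unit ball of h lies in l times the unit ball of g. -/
theorem isVonNBounded_stretchedInner (g : SmoothMetric E Y)
    (hgrad : ∀ p : Y, innerAt g p (gradAt g f p) (gradAt g f p) = 1) {l : ℝ} (hl : 1 ≤ l)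
    (p : Y) : Bornology.IsVonNBounded ℝ {v : E | stretchedInner g f l p v v < 1} := by
  have hl0 : l ≠ 0 := by positivity
  have hg : Bornology.IsVonNBounded ℝ {v : E | innerAt g p v v < 1} := g.isVonNBounded p
  refine (hg.image (l • ContinuousLinearMap.id ℝ E)).subset ?_
  intro v hv
  refine ⟨l⁻¹ • v, ?_, by simp [smul_smul, hl0]⟩
  have h1 := inner_le_mul_stretchedInner g hgrad hl p v
  have h2 : stretchedInner g f l p v v < 1 := hv
  have h3 : innerAt g p v v < l ^ 2 := by
    have : 0 < l ^ 2 := by positivity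
    nlinarith
  show innerAt g p (l⁻¹ • v) (l⁻¹ • v) < 1
  simp only [map_smul, smul_apply, smul_eq_mul]
  rw [← mul_assoc, ← mul_inv, ← sq, inv_mul_lt_iff₀ (by positivity), mul_one]
  exact h3

theorem stretchedInner_smul_grad_add (g : SmoothMetric E Y)
    (hgrad : ∀ p : Y, innerAt g p (gradAt g f p) (gradAt g f p) = 1) (l : ℝ)
    (p : Y) (s t : ℝ) (u v : E) (hu : innerAt g p u (gradAt g f p) = 0)
    (hv : innerAt g p v (gradAt g f p) = 0) :
    stretchedInner g f l p (s • gradAt g f p + u) (t • gradAt g f p + v) =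
      s * t / l ^ 2 + innerAt g p u v := by
  have hd (w : E) : differentialAt f p w = innerAt g p w (gradAt g f p) := by
    rw [innerAt_symm, innerAt_gradAt]
  have hv' : innerAt g p (gradAt g f p) v = 0 := by rw [innerAt_symm, hv]
  have h1 : innerAt g p (gradAt g f p) (gradAt g f p) = 1 := hgrad p
  rw [stretchedInner_apply, hd, hd]
  simp only [map_add, map_smul, add_apply, smul_apply, smul_eq_mul, hu, hv, hv', h1]
  ring

/-- The smooth Riemannian metric `g - (1 - l⁻²) df ⊗ df`. -/
def stretchedMetric (g : SmoothMetric E Y) (hf : ContMDiff 𝓘(ℝ, E) 𝓘(ℝ, ℝ) ∞ f)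
    (hgrad : ∀ p : Y, innerAt g p (gradAt g f p) (gradAt g f p) = 1) {l : ℝ} (hl : 1 ≤ l) :
    SmoothMetric E Y where
  inner := stretchedInner g f l
  symm p u v := stretchedInner_symm g f l p u v
  pos p v hv := stretchedInner_pos g hgrad hl p v hv
  isVonNBounded p := isVonNBounded_stretchedInner g hgrad hl p
  contMDiff p := by
    refine contMDiffAt_bilin_section _ p fun u v => ?_
    have hu := contMDiffAt_trivialization_symm p u (mem_chart_source E p)
    have hv := contMDiffAt_trivialization_symm p v (mem_chart_source E p)
    exact (g.contMDiffAt_apply hu hv).sub (contMDiffAt_const.mul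
      ((contMDiffAt_mfderiv_apply hf hu).mul (contMDiffAt_mfderiv_apply hf hv)))

theorem isStretchedMetric_stretchedMetric (g : SmoothMetric E Y)
    (hf : ContMDiff 𝓘(ℝ, E) 𝓘(ℝ, ℝ) ∞ f)
    (hgrad : ∀ p : Y, innerAt g p (gradAt g f p) (gradAt g f p) = 1) {l : ℝ} (hl : 1 ≤ l) :
    IsStretchedMetric g f l (stretchedMetric g hf hgrad hl) :=
  fun p s t u v hu hv => stretchedInner_smul_grad_add g hgrad l p s t u v hu hv

theorem isCoordStretchOn_stretchedMetric (g : SmoothMetric E Y)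
    (hf : ContMDiff 𝓘(ℝ, E) 𝓘(ℝ, ℝ) ∞ f)
    (hgrad : ∀ p : Y, innerAt g p (gradAt g f p) (gradAt g f p) = 1) {l : ℝ} (hl : 1 ≤ l)
    (q : Y) :
    IsCoordStretchOn (coordMetric g q) (coordMetric (stretchedMetric g hf hgrad hl) q)
      (f ∘ (extChartAt 𝓘(ℝ, E) q).symm) l (extChartAt 𝓘(ℝ, E) q).target := by
  intro x hx u v
  rw [fderiv_comp_extChartAt_symm hf hx, fderiv_comp_extChartAt_symm hf hx]
  rfl

end StretchedMetric

/-! ### From convex levels to Hessian bounds -/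

section GeodesicsOnManifold

variable {E : Type*} [NormedAddCommGroup E] [NormedSpace ℝ E] [FiniteDimensional ℝ E]
  {Y : Type*} [TopologicalSpace Y] [ChartedSpace E Y] [IsManifold 𝓘(ℝ, E) ∞ Y]
  {f : Y → ℝ} {g : SmoothMetric E Y} {q : Y} {ε : ℝ} {γ y : ℝ → E}

theorem IsCoordGeodesic.velocity_eq
    (h : IsCoordGeodesic (coordMetric g q) (extChartAt 𝓘(ℝ, E) q).target ε γ y) {t : ℝ}
    (ht : t ∈ Set.Ioo (-ε) ε) :
    velocity (E := E) ((extChartAt 𝓘(ℝ, E) q).symm ∘ γ) t = chartInvDeriv q (γ t) (y t) := by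
  have h1 := (h.hasDerivAt t ht).hasFDerivAt.hasMFDerivAt
  have h2 := ((contMDiffAt_extChartAt_symm (h.mem t ht)).mdifferentiableAt
    (by simp)).hasMFDerivAt
  rw [velocity, (h2.comp t h1).mfderiv]
  exact congrArg (chartInvDeriv q (γ t)) (one_smul ℝ (y t))

/-- A solution of the geodesic equation in a chart is a geodesic of the manifold. -/
theorem IsCoordGeodesic.isUnitSpeedGeodesicOn
    (h : IsCoordGeodesic (coordMetric g q) (extChartAt 𝓘(ℝ, E) q).target ε γ y)
    (h0 : coordMetric g q (γ 0) (y 0) (y 0) = 1) :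
    IsUnitSpeedGeodesicOn g ((extChartAt 𝓘(ℝ, E) q).symm ∘ γ) (-ε) ε := by
  have hG := isCoordMetricOn_coordMetric g q
  refine ⟨⟨?_, fun t ht => ⟨q, extChartAt_symm_mem_source (h.mem t ht), ?_⟩⟩, fun t ht => ?_⟩
  · exact ((contMDiffOn_extChartAt_symm (I := 𝓘(ℝ, E)) (n := ∞) q).of_le
      (WithTop.coe_le_coe.mpr le_top)).comp (h.contDiffOn hG).contMDiffOn h.mem
  · have h1 : (fun s => extChartAt 𝓘(ℝ, E) q (((extChartAt 𝓘(ℝ, E) q).symm ∘ γ) s)) =ᶠ[𝓝 t] γ := by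
      filter_upwards [isOpen_Ioo.mem_nhds ht] with s hs
      exact (extChartAt 𝓘(ℝ, E) q).right_inv (h.mem s hs)
    simp only
    rw [h1.deriv.deriv_eq, h1.deriv_eq, h.deriv_deriv ht, (h.hasDerivAt t ht).deriv, h1.eq_of_nhds]
    exact neg_add_cancel _
  · have h1 := h.speed_eq hG ht
    rw [h0, coordMetric_apply] at h1
    rw [h.velocity_eq ht]
    exact h1

/-- Pinched convexity of the levels bounds the Hessian on vectors tangent to the levels. -/
theorem coordHessian_bounds_of_levels (hf : ContMDiff 𝓘(ℝ, E) 𝓘(ℝ, ℝ) ∞ f) {c₁ c₂ : ℝ}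
    (hlev : ∀ (η : ℝ) (c : ℝ → Y), 0 < η → IsUnitSpeedGeodesicOn g c (-η) η →
      g.inner (c 0) (velocity c 0) (riemGrad g f (c 0)) = 0 →
        c₁ ≤ deriv (deriv (f ∘ c)) 0 ∧ deriv (deriv (f ∘ c)) 0 ≤ c₂)
    (hgrad : ∀ p : Y, innerAt g p (gradAt g f p) (gradAt g f p) = 1) {x : E}
    (hx : x ∈ (extChartAt 𝓘(ℝ, E) q).target) (u : E)
    (hu : fderiv ℝ (f ∘ (extChartAt 𝓘(ℝ, E) q).symm) x u = 0) :
    c₁ * coordMetric g q x u u ≤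
        coordHessian (coordMetric g q) (f ∘ (extChartAt 𝓘(ℝ, E) q).symm) x u u ∧
      coordHessian (coordMetric g q) (f ∘ (extChartAt 𝓘(ℝ, E) q).symm) x u u ≤
        c₂ * coordMetric g q x u u := by
  have hG := isCoordMetricOn_coordMetric g q
  have hφ := isUnitGradientOn_comp_extChartAt_symm g hf hgrad q
  -- For a unit vector tangent to the level, the convexity hypothesis is applied to the geodesic it
  -- generates in the chart.
  have hunit (v : E) (hv : coordMetric g q x v v = 1)
      (hv0 : fderiv ℝ (f ∘ (extChartAt 𝓘(ℝ, E) q).symm) x v = 0) :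
      c₁ ≤ coordHessian (coordMetric g q) (f ∘ (extChartAt 𝓘(ℝ, E) q).symm) x v v ∧
        coordHessian (coordMetric g q) (f ∘ (extChartAt 𝓘(ℝ, E) q).symm) x v v ≤ c₂ := by
    obtain ⟨ε, hε, γ, y, rfl, rfl, h⟩ := hG.exists_coordGeodesic hx v
    have h0 : (0 : ℝ) ∈ Set.Ioo (-ε) ε := ⟨by linarith, hε⟩
    rw [← h.deriv_deriv_comp hG hφ.contDiffOn h0]
    refine hlev ε ((extChartAt 𝓘(ℝ, E) q).symm ∘ γ) hε (h.isUnitSpeedGeodesicOn hv) ?_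
    refine (g.symm _ _ _).trans ?_
    rw [h.velocity_eq h0]
    rw [fderiv_comp_extChartAt_symm hf hx] at hv0
    exact (innerAt_gradAt g f _ _).trans hv0
  clear hlev
  generalize f ∘ (extChartAt 𝓘(ℝ, E) q).symm = φ at *
  rcases eq_or_ne u 0 with rfl | hu0
  · have h := coordHessian_smul_right (φ := φ) hG hx 0 0 0
    rw [zero_smul, zero_mul] at h
    simp [h]
  · have hpos := hG.pos x hx u hu0
    -- The general case follows by normalizing u, as the Hessian and the metric are both homogeneous
    -- of degree two.
    set r := √(coordMetric g q x u u) with hr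
    have hr0 : 0 < r := Real.sqrt_pos.2 hpos
    have hr2 : r * r = coordMetric g q x u u := Real.mul_self_sqrt hpos.le
    have h := hunit (r⁻¹ • u) (by
      simp only [map_smul, smul_apply, smul_eq_mul, ← hr2]
      field_simp) (by simp [hu])
    rw [coordHessian_smul_right hG hx, coordHessian_symm hφ hG hx, coordHessian_smul_right hG hx]
      at h
    have e : coordHessian (coordMetric g q) φ x u u =
        (r⁻¹ * (r⁻¹ * coordHessian (coordMetric g q) φ x u u))
          * (r * r) := by field_simp
    rw [e, ← hr2]
    exact ⟨mul_le_mul_of_nonneg_right h.1 (by positivity),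
      mul_le_mul_of_nonneg_right h.2 (by positivity)⟩

end GeodesicsOnManifold

/-! ### Comparison of Riemannian distances -/

section Distances

variable {E : Type*} [NormedAddCommGroup E] [NormedSpace ℝ E]
  {Y : Type*} [TopologicalSpace Y] [ChartedSpace E Y] [IsManifold 𝓘(ℝ, E) ∞ Y]

/-- The Riemannian distance as an infimum over `C^1` paths of integrals of `√(g(γ', γ'))`. -/
theorem riemDist_eq (g : SmoothMetric E Y) (p q : Y) :
    riemDist g p q = ⨅ (γ : Path p q)
        (_ : ContMDiff (modelWithCornersEuclideanHalfSpace 1) 𝓘(ℝ, E) 1 γ),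
      ∫⁻ t, ENNReal.ofReal √(g.inner (γ t)
        (mfderiv (modelWithCornersEuclideanHalfSpace 1) 𝓘(ℝ, E) γ t 1)
        (mfderiv (modelWithCornersEuclideanHalfSpace 1) 𝓘(ℝ, E) γ t 1)) := by
  let _ : Bundle.RiemannianBundle (fun p : Y => TangentSpace 𝓘(ℝ, E) p) := ⟨g.toRiemannianMetric⟩
  have hnorm (p : Y) (v : TangentSpace 𝓘(ℝ, E) p) :
      ‖v‖ₑ = ENNReal.ofReal √(g.inner p v v) := by
    rw [← ofReal_norm]
    rfl
  unfold riemDist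
  rw [Manifold.riemannianEDist]
  simp only [hnorm]

/-- The lengths compare path by path. The condition C ≠ 0 lets the constant pass through the infimum
in `ℝ≥0∞`, where an infimum over no paths is ∞. -/
theorem riemDist_le_mul (g h : SmoothMetric E Y) {C : ℝ≥0} (hC : C ≠ 0)
    (H : ∀ (p : Y) (v : E), innerAt g p v v ≤ C ^ 2 * innerAt h p v v) (p q : Y) :
    riemDist g p q ≤ C * riemDist h p q := by
  have hC' : (C : ℝ≥0∞) ≠ 0 := by simpa using hC
  rw [riemDist_eq, riemDist_eq]
  simp only [ENNReal.mul_iInf_of_ne hC' ENNReal.coe_ne_top]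
  refine iInf₂_mono fun γ _ => ?_
  rw [← MeasureTheory.lintegral_const_mul' _ _ ENNReal.coe_ne_top]
  refine MeasureTheory.lintegral_mono fun t => ?_
  rw [← ENNReal.ofReal_coe_nnreal, ← ENNReal.ofReal_mul C.coe_nonneg]
  refine ENNReal.ofReal_le_ofReal ?_
  rw [← Real.sqrt_sq C.coe_nonneg, ← Real.sqrt_mul (sq_nonneg _)]
  exact Real.sqrt_le_sqrt (H _ _)

end Distances

end

/-! ### The main theorem -/

theorem lemma1 {E : Type*} [NormedAddCommGroup E] [NormedSpace ℝ E] [FiniteDimensional ℝ E]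
    {Y : Type*} [TopologicalSpace Y] [T2Space Y] [SecondCountableTopology Y]
    [ChartedSpace E Y] [IsManifold 𝓘(ℝ, E) ∞ Y]
    (g : SmoothMetric E Y) (hcomplete : IsCompleteMetric g)
    (Λ δ : ℝ) (hδ : 0 < δ)
    (hK : ∀ (p : Y) (u v : TangentSpace 𝓘(ℝ, E) p), LinearIndependent ℝ ![u, v] →
      |sectionalCurvature g p u v| ≤ Λ)
    (f : Y → ℝ) (hf : ContMDiff 𝓘(ℝ, E) 𝓘(ℝ, ℝ) ∞ f)
    (hgrad : ∀ p : Y, g.inner p (riemGrad g f p) (riemGrad g f p) = 1)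
    (hlevels : HasPinchedConvexLevels g f)
    (hKgrad : ∀ (p : Y) (u v : TangentSpace 𝓘(ℝ, E) p), LinearIndependent ℝ ![u, v] →
      riemGrad g f p ∈ Submodule.span ℝ {u, v} → sectionalCurvature g p u v < -δ) :
    ∃ l₀ : ℝ, 0 < l₀ ∧ ∀ l : ℝ, l₀ ≤ l → ∃ h : SmoothMetric E Y,
      IsStretchedMetric g f l h ∧ HasPinchedNegativeCurvature h ∧ LipschitzEquivalent g h := by
  obtain ⟨c₁, c₂, hc₁, hc, hlev⟩ := hlevels
  -- Λ can be negative, for instance when there are no tangent planes; the estimates need a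
  -- nonnegative bound.
  set M := max Λ 0 with hM
  have hM0 : 0 ≤ M := le_max_right _ _
  set A := (M * (2 * M / δ + 1) + M + 1) / c₁ ^ 2 with hA
  have hA0 : 0 ≤ A := by positivity
  -- For l ≥ 1 + A one has l² - 1 ≥ 2A + A² ≥ A, which is the absorption condition with t = 2M/δ +
  -- 1; also l ≥ 1.
  refine ⟨1 + A, by positivity, fun l hl => ?_⟩
  have hl1 : 1 ≤ l := by linarith
  have hl2 : M * (2 * M / δ + 1) + M + 1 ≤ (l ^ 2 - 1) * c₁ ^ 2 := by
    rw [← div_le_iff₀ (by positivity), ← hA]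
    nlinarith
  refine ⟨stretchedMetric g hf hgrad hl1, isStretchedMetric_stretchedMetric g hf hgrad hl1, ?_, ?_⟩
  · set a := √(min (δ / 2) 1) with ha
    set b := √(M * l ^ 2 + (l ^ 2 - 1) * c₂ ^ 2) with hb
    have hl3 : 0 ≤ l ^ 2 - 1 := by nlinarith
    have ha2 : a ^ 2 = min (δ / 2) 1 := Real.sq_sqrt (by positivity)
    have hb2 : b ^ 2 = M * l ^ 2 + (l ^ 2 - 1) * c₂ ^ 2 := Real.sq_sqrt (by positivity)
    have ha0 : 0 < a := Real.sqrt_pos.2 (by positivity)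
    -- Taking the maximum supplies the required a ≤ b without comparing the two constants.
    refine ⟨a, max a b, ha0, le_max_left _ _, fun p u v huv => ?_⟩
    have hx := mem_extChartAt_target (I := 𝓘(ℝ, E)) p
    have key := coordSectionalCurvature_stretch_bounds (Λ := M) (δ := δ) (c₁ := c₁) (c₂ := c₂)
      (isUnitGradientOn_comp_extChartAt_symm g hf hgrad p)
      (isCoordMetricOn_coordMetric g p) (isCoordMetricOn_coordMetric _ p)
      (isCoordStretchOn_stretchedMetric g hf hgrad hl1 p) hx hM0 hδ hc₁ hc
      (fun u v huv => by
        exact sectionalCurvature_eq g p u v ▸ (hK p u v huv).trans (le_max_left _ _))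
      (fun u v huv hN => by
        rw [coordGrad_self g hf] at hN
        exact sectionalCurvature_eq g p u v ▸ hKgrad p u v huv hN)
      (fun u hu => coordHessian_bounds_of_levels hf hlev hgrad hx u hu)
      hl1 hl2 (u := u) (v := v) huv
    have hsec := sectionalCurvature_eq (stretchedMetric g hf hgrad hl1) p u v
    rw [← hsec, ← ha2, ← hb2] at key
    refine ⟨?_, key.2⟩
    have : b ^ 2 ≤ max a b ^ 2 := by gcongr; exact le_max_right _ _
    linarith [key.1]
  · lift l to ℝ≥0 using by positivity
    have hl0 : l ≠ 0 := by
      rintro rfl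
      norm_num at hl1
    -- The constant L = l serves both directions, by g ≤ l²h and h ≤ g ≤ l²g.
    refine ⟨l, fun p q => ⟨riemDist_le_mul _ _ hl0 (fun p v => ?_) p q, ?_⟩⟩
    · exact inner_le_mul_stretchedInner g hgrad hl1 p v
    · refine riemDist_le_mul _ _ hl0 (fun p v => ?_) p q
      have h1 : stretchedInner g f l p v v ≤ innerAt g p v v := stretchedInner_le_inner g hl1 p v
      have h2 : innerAt g p v v ≤ l ^ 2 * innerAt g p v v := by
        have : 0 ≤ innerAt g p v v := by
          rcases eq_or_ne v 0 with rfl | hv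
          · simp
          · exact (innerAt_pos g p v hv).le
        exact le_mul_of_one_le_left this (one_le_pow₀ hl1)
      exact h1.trans h2
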